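/- Let $\Bbbk$ be a field and let $(H,\mathbf g)$ be a finite-dimensional pivotal Hopf algebra over $\Bbbk$ with coproduct $\Delta$, counit $\epsilon$ and antipode $S$, i.e. $\mathbf g\in H$ is a group-like element with $S^2(x)=\mathbf g x\mathbf g^{-1}$ for all $x\in H$. Assume that $H$ is unimodular: every $c\in H$ with $cx=\epsilon(x)c$ for all $x$ (a right cointegral) also satisfies $xc=\epsilon(x)c$ for all $x$ (is a left cointegral). A right (resp. left) integral is a linear form $\mu$ (resp. $\mu^l$) on $H$ with $(\mu\otimes\mathrm{id})\Delta(x)=\mu(x)\mathbf 1$ (resp. $(\mathrm{id}\otimes\mu^l)\Delta(x)=\mu^l(x)\mathbf 1$) for all $x\in H$. The symmetrised right (resp. left) integrals are the forms $\mu_{\mathbf g}(x)=\mu(\mathbf g x)$ (resp. $\mu^l_{\mathbf g^{-1}}(x)=\mu^l(\mathbf g^{-1}x)$). $(H,\mathbf g)$ is unibalanced if its symmetrised right integrals are also symmetrised left integrals. Let $H\text{-mod}$ be the category of finite-dimensional left $H$-modules, with $V^*=\mathrm{Hom}_\Bbbk(V,\Bbbk)$, $(h\varphi)(v)=\varphi(S(h)v)$,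 and let $H\text{-pmod}$ be its full subcategory of projective modules. With a basis $(v_i)$ of $V$ put $\mathrm{ev}_V(\varphi\otimes v)=\varphi(v)$, $\mathrm{coev}_V(1)=\sum_i v_i\otimes v_i^*$, $\widetilde{\mathrm{ev}}_V(v\otimes\varphi)=\varphi(\mathbf g v)$, $\widetilde{\mathrm{coev}}_V(1)=\sum_i v_i^*\otimes\mathbf g^{-1}v_i$, and for $f\in\mathrm{End}_H(W\otimes V)$ $$\mathrm{tr}^r_V(f)=(\mathrm{id}_W\otimes\widetilde{\mathrm{ev}}_V)(f\otimes\mathrm{id}_{V^*})(\mathrm{id}_W\otimes\mathrm{coev}_V),\qquad \mathrm{tr}^l_W(f)=(\mathrm{ev}_W\otimes\mathrm{id}_V)(\mathrm{id}_{W^*}\otimes f)(\widetilde{\mathrm{coev}}_W\otimes\mathrm{id}_V).$$ A right (resp. left) modified trace is a family of linear forms $\mathsf t_P:\mathrm{End}_H(P)\to\Bbbk$, $P\in H\text{-pmod}$, with $\mathsf t_P(b\circ a)=\mathsf t_{P'}(a\circ b)$ for all $a:P\to P'$, $b:P'\to P$ in $H\text{-pmod}$, and $\mathsf t_{P\otimes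 V}(f)=\mathsf t_P(\mathrm{tr}^r_V(f))$ for all $f\in\mathrm{End}_H(P\otimes V)$ (resp. $\mathsf t_{V\otimes P}(f)=\mathsf t_P(\mathrm{tr}^l_V(f))$ for all $f\in\mathrm{End}_H(V\otimes P)$), for all $P\in H\text{-pmod}$ and $V\in H\text{-mod}$. It is non-degenerate if the pairings $\mathrm{Hom}_H(M,P)\times\mathrm{Hom}_H(P,M)\to\Bbbk$, $(a,b)\mapsto\mathsf t_P(a\circ b)$, are non-degenerate for all $P\in H\text{-pmod}$ and $M\in H\text{-mod}$. **Theorem 1.** There is a linear isomorphism from the space of right modified traces on $H\text{-pmod}$ onto the space of symmetrised right integrals, sending $\mathsf t$ to the form $\lambda$ with $\mathsf t_H(f)=\lambda(f(\mathbf 1))$ for all $f\in\mathrm{End}_H(H)$ ($H$ the left regular module); both spaces are 1-dimensional. Every non-zero right modified trace is non-degenerate, and for every non-zero right integral $\mu$ there is exactly one right modified trace with $\mathsf t_H(f)=\mu(\mathbf g f(\mathbf 1))$ for all $f\in\mathrm{End}_H(H)$. The same holds for left modified traces and symmetrised left integrals, with $\mathsf t_H(f)=\mu^l(\mathbf g^{-1}f(\mathbf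 1))$ for non-zero left integrals $\mu^l$. Finally, $(H,\mathbf g)$ is unibalanced if and only if every right modified trace is also a left modified trace. -/

import Mathlib

open scoped TensorProduct

universe u

noncomputable section

namespace HopfTrace

/-! ### Integrals, cointegrals, pivots -/

section Integrals

variable (k H : Type u) [Field k] [Ring H] [HopfAlgebra k H]

/-- The space of right integrals: linear forms `μ` with `(μ ⊗ id) Δ(x) = μ(x) 1`. -/
def rightIntegrals : Submodule k (Module.Dual k H) where
  carrier := {μ | ∀ x : H, TensorProduct.lid k H
    (TensorProduct.map μ LinearMap.id (Coalgebra.comul (R := k) x)) = μ x • (1 : H)}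
  zero_mem' := by intro x; simp [TensorProduct.map_zero_left]
  add_mem' := by
    intro μ ν hμ hν x
    simp only [TensorProduct.map_add_left, LinearMap.add_apply, map_add, add_smul, hμ x, hν x]
  smul_mem' := by
    intro c μ hμ x
    simp only [TensorProduct.map_smul_left, LinearMap.smul_apply, map_smul, hμ x, smul_assoc]

/-- The space of left integrals: linear forms `μ` with `(id ⊗ μ) Δ(x) = μ(x) 1`. -/
def leftIntegrals : Submodule k (Module.Dual k H) where
  carrier := {μ | ∀ x : H, TensorProduct.rid k H
    (TensorProduct.map LinearMap.id μ (Coalgebra.comul (R := k) x)) = μ x • (1 : H)}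
  zero_mem' := by intro x; simp [TensorProduct.map_zero_right]
  add_mem' := by
    intro μ ν hμ hν x
    simp only [TensorProduct.map_add_right, LinearMap.add_apply, map_add, add_smul, hμ x, hν x]
  smul_mem' := by
    intro c μ hμ x
    simp only [TensorProduct.map_smul_right, LinearMap.smul_apply, map_smul, hμ x, smul_assoc]

variable {H} in
/-- `c` is a left cointegral: `x c = ε(x) c` for all `x`. -/
def IsLeftCointegral (c : H) : Prop :=
  ∀ x : H, x * c = Coalgebra.counit (R := k) x • c

variable {H} in
/-- `c` is a right cointegral: `c x = ε(x) c` for all `x`. -/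
def IsRightCointegral (c : H) : Prop :=
  ∀ x : H, c * x = Coalgebra.counit (R := k) x • c

/-- `H` is unimodular: right cointegrals are also left cointegrals. -/
def IsUnimodular : Prop :=
  ∀ c : H, IsRightCointegral k c → IsLeftCointegral k c

/-- A pivot of `H`: a group-like element `g` with `S²(x) = g x g⁻¹` for all `x`. -/
structure Pivot where
  /-- the group-like element -/
  g : GroupLike k H
  antipode_antipode : ∀ x : H,
    HopfAlgebra.antipode k (HopfAlgebra.antipode k x) = (g : H) * x * ((g⁻¹ : GroupLike k H) : H)

variable {k H}

/-- The space of symmetrised right integrals `x ↦ μ(g x)`, `μ` a right integral. -/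
def symRightIntegrals (p : Pivot k H) : Submodule k (Module.Dual k H) :=
  (rightIntegrals k H).map (LinearMap.mulLeft k (p.g : H)).dualMap

/-- The space of symmetrised left integrals `x ↦ μ(g⁻¹ x)`, `μ` a left integral. -/
def symLeftIntegrals (p : Pivot k H) : Submodule k (Module.Dual k H) :=
  (leftIntegrals k H).map (LinearMap.mulLeft k ((p.g⁻¹ : GroupLike k H) : H)).dualMap

/-- `(H, g)` is unibalanced: symmetrised right integrals are also symmetrised left integrals. -/
def IsUnibalanced (p : Pivot k H) : Prop :=
  ∀ φ ∈ symRightIntegrals p, φ ∈ symLeftIntegrals p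

end Integrals

/-! ### The pivotal category of finite-dimensional left `H`-modules -/

/-- A finite-dimensional left `H`-module; the morphisms `V ⟶ W` are the `H`-linear maps
`V →ₗ[H] W`. -/
structure FDMod (k H : Type u) [Field k] [Ring H] [Algebra k H] where
  /-- the underlying set -/
  carrier : Type u
  [addCommGroup : AddCommGroup carrier]
  [moduleField : Module k carrier]
  [moduleAlg : Module H carrier]
  [isScalarTower : IsScalarTower k H carrier]
  [finite : FiniteDimensional k carrier]

namespace FDMod

section Basic

variable {k H : Type u} [Field k] [Ring H] [Algebra k H]

instance : CoeSort (FDMod k H) (Type u) := ⟨FDMod.carrier⟩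

attribute [instance] FDMod.addCommGroup FDMod.moduleField FDMod.moduleAlg FDMod.isScalarTower
  FDMod.finite

/-- The `k`-linear map by which `h : H` acts on `V`. -/
def act (V : FDMod k H) : H →ₐ[k] Module.End k V := Algebra.lsmul k k V

@[simp] lemma act_apply (V : FDMod k H) (h : H) (v : V) : V.act h v = h • v := rfl

/-- The `H`-module given by an algebra map `H → End_k(M)`. -/
def ofAlgHom (M : Type u) [AddCommGroup M] [Module k M] [FiniteDimensional k M]
    (ρ : H →ₐ[k] Module.End k M) : FDMod k H :=
  letI : Module H M := Module.compHom M (ρ : H →+* Module.End k M)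
  { carrier := M
    isScalarTower := ⟨fun c h m => by
      change ρ (c • h) m = c • ρ h m
      rw [map_smul, LinearMap.smul_apply]⟩ }

/-- The (identity) identification of `M` with the underlying space of `ofAlgHom M ρ`. -/
def ofEquiv (M : Type u) [AddCommGroup M] [Module k M] [FiniteDimensional k M]
    (ρ : H →ₐ[k] Module.End k M) : M ≃ₗ[k] ofAlgHom M ρ :=
  LinearEquiv.refl k M

lemma ofEquiv_smul (M : Type u) [AddCommGroup M] [Module k M] [FiniteDimensional k M]
    (ρ : H →ₐ[k] Module.End k M) (h : H) (m : M) :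
    h • ofEquiv M ρ m = ofEquiv M ρ (ρ h m) := rfl

/-- A `k`-linear map commuting with the `H`-actions is a morphism of `H`-modules. -/
def mkHom {V W : FDMod k H} (F : V →ₗ[k] W) (hF : ∀ (h : H) (v : V), F (h • v) = h • F v) :
    V →ₗ[H] W where
  toFun := F
  map_add' := map_add F
  map_smul' := hF

@[simp] lemma mkHom_apply {V W : FDMod k H} (F : V →ₗ[k] W)
    (hF : ∀ (h : H) (v : V), F (h • v) = h • F v) (v : V) : mkHom F hF v = F v := rfl

/-- The left regular module `H`. -/
def regular (k H : Type u) [Field k] [Ring H] [Algebra k H] [FiniteDimensional k H] :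
    FDMod k H where
  carrier := H

/-- The element `f(1) ∈ H`, for an endomorphism `f` of the left regular module. -/
def valueAtOne [FiniteDimensional k H] (f : regular k H →ₗ[H] regular k H) : H :=
  (show H →ₗ[H] H from f) 1

end Basic

section Monoidal

variable {k H : Type u} [Field k] [Ring H] [HopfAlgebra k H]

/-- The tensor unit: `k` with `h • c = ε(h) c`. -/
def unit (k H : Type u) [Field k] [Ring H] [HopfAlgebra k H] : FDMod k H :=
  ofAlgHom k ((Algebra.lsmul k k k).comp (Bialgebra.counitAlgHom k H))

/-- The tensor product `V ⊗ W` over `k`, with `h • (v ⊗ w) = ∑ h₁ v ⊗ h₂ w`. -/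
def tensor (V W : FDMod k H) : FDMod k H :=
  ofAlgHom (V ⊗[k] W)
    ((Module.endTensorEndAlgHom (R := k) (S := k) (A := k)).comp
      ((Algebra.TensorProduct.map V.act W.act).comp (Bialgebra.comulAlgHom k H)))

/-- The dual `V^* = Hom_k(V, k)` with `(h • φ)(v) = φ(S(h) v)`. -/
def dual (V : FDMod k H) : FDMod k H :=
  ofAlgHom (Module.Dual k V)
    { toFun := fun h => (V.act (HopfAlgebra.antipode k h)).dualMap
      map_one' := by ext; simp
      map_mul' := fun a b => by
        ext; simp [HopfAlgebra.antipode_mul_antidistrib]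
      map_zero' := by ext; simp
      map_add' := fun a b => by ext; simp
      commutes' := fun c => by
        ext; simp [Algebra.algebraMap_eq_smul_one] }

/-- The identification of `k` with the underlying space of the unit object. -/
def unitEquiv (k H : Type u) [Field k] [Ring H] [HopfAlgebra k H] : k ≃ₗ[k] unit k H :=
  ofEquiv _ _

/-- The identification of `V ⊗[k] W` with the underlying space of `tensor V W`. -/
def tensorEquiv (V W : FDMod k H) : V ⊗[k] W ≃ₗ[k] tensor V W := ofEquiv _ _

/-- The identification of `Hom_k(V, k)` with the underlying space of `dual V`. -/
def dualEquiv (V : FDMod k H) : Module.Dual k V ≃ₗ[k] dual V := ofEquiv _ _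

lemma smul_unitEquiv (h : H) (c : k) :
    h • unitEquiv k H c = unitEquiv k H (Coalgebra.counit (R := k) h * c) := rfl

lemma smul_dualEquiv (V : FDMod k H) (h : H) (φ : Module.Dual k V) :
    h • dualEquiv V φ = dualEquiv V (φ ∘ₗ V.act (HopfAlgebra.antipode k h)) := rfl

lemma smul_tensorEquiv (V W : FDMod k H) (h : H) (x : V ⊗[k] W) {ι : Type*}
    (r : Coalgebra.Repr k h ι) :
    h • tensorEquiv V W x = tensorEquiv V W
      (∑ i ∈ r.index, TensorProduct.map (V.act (r.left i)) (W.act (r.right i)) x) := by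
  refine (ofEquiv_smul _ _ h x).trans (congrArg (tensorEquiv V W) ?_)
  change (Module.endTensorEndAlgHom (R := k) (S := k) (A := k)
    ((Algebra.TensorProduct.map V.act W.act) (Coalgebra.comul (R := k) h)) :
      Module.End k (V ⊗[k] W)) x = _
  rw [← r.eq, map_sum, map_sum, LinearMap.sum_apply]
  rfl

lemma smul_tensorEquiv_tmul (V W : FDMod k H) (h : H) (v : V) (w : W) {ι : Type*}
    (r : Coalgebra.Repr k h ι) :
    h • tensorEquiv V W (v ⊗ₜ[k] w) =
      tensorEquiv V W (∑ i ∈ r.index, (r.left i • v) ⊗ₜ[k] (r.right i • w)) := by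
  rw [smul_tensorEquiv V W h _ r]; rfl

/-- A `k`-linear map out of a tensor product is `H`-linear if it is so on pure tensors. -/
def mkTensorHom {V W X : FDMod k H} (F : V ⊗[k] W →ₗ[k] X)
    (hF : ∀ (h : H) (v : V) (w : W),
      ∑ i ∈ (Coalgebra.Repr.arbitrary k h).index,
        F (((Coalgebra.Repr.arbitrary k h).left i • v) ⊗ₜ[k]
          ((Coalgebra.Repr.arbitrary k h).right i • w)) = h • F (v ⊗ₜ[k] w)) :
    tensor V W →ₗ[H] X :=
  mkHom (F ∘ₗ (tensorEquiv V W).symm.toLinearMap) (by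
    intro h y
    obtain ⟨x, rfl⟩ := (tensorEquiv V W).surjective y
    induction x using TensorProduct.induction_on with
    | zero => simp
    | tmul v w =>
      rw [smul_tensorEquiv_tmul V W h v w (Coalgebra.Repr.arbitrary k h)]
      simpa using hF h v w
    | add x y hx hy => simp only [map_add, smul_add, hx, hy])

@[simp] lemma mkTensorHom_apply {V W X : FDMod k H} (F : V ⊗[k] W →ₗ[k] X) (hF) (x : V ⊗[k] W) :
    mkTensorHom F hF (tensorEquiv V W x) = F x := by
  simp [mkTensorHom]

/-- The tensor product `f ⊗ g` of two morphisms. -/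
def tensorHom {V V' W W' : FDMod k H} (f : V →ₗ[H] V') (g : W →ₗ[H] W') :
    tensor V W →ₗ[H] tensor V' W' :=
  mkTensorHom ((tensorEquiv V' W').toLinearMap ∘ₗ
      TensorProduct.map (f.restrictScalars k) (g.restrictScalars k)) (by
    intro h v w
    simp [smul_tensorEquiv_tmul V' W' h (f v) (g w) (Coalgebra.Repr.arbitrary k h)])

@[simp] lemma tensorHom_tmul {V V' W W' : FDMod k H} (f : V →ₗ[H] V') (g : W →ₗ[H] W')
    (v : V) (w : W) :
    tensorHom f g (tensorEquiv V W (v ⊗ₜ w)) = tensorEquiv V' W' (f v ⊗ₜ g w) := by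
  simp [tensorHom]

/-- A `k`-linear equivalence commuting with the `H`-actions is an isomorphism of `H`-modules. -/
def mkEquiv {V W : FDMod k H} (e : V ≃ₗ[k] W) (he : ∀ (h : H) (v : V), e (h • v) = h • e v) :
    V ≃ₗ[H] W :=
  { mkHom e.toLinearMap he with
    invFun := e.symm
    left_inv := e.symm_apply_apply
    right_inv := e.apply_symm_apply }

@[simp] lemma mkEquiv_apply {V W : FDMod k H} (e : V ≃ₗ[k] W)
    (he : ∀ (h : H) (v : V), e (h • v) = h • e v) (v : V) : mkEquiv e he v = e v := rfl

@[simp] lemma mkEquiv_symm_apply {V W : FDMod k H} (e : V ≃ₗ[k] W)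
    (he : ∀ (h : H) (v : V), e (h • v) = h • e v) (w : W) : (mkEquiv e he).symm w = e.symm w := rfl

/-- The left unitor `1 ⊗ V ≅ V`. -/
def leftUnitor (V : FDMod k H) : tensor (unit k H) V ≃ₗ[H] V :=
  mkEquiv ((tensorEquiv (unit k H) V).symm ≪≫ₗ
      TensorProduct.congr (unitEquiv k H).symm (LinearEquiv.refl k V) ≪≫ₗ
      TensorProduct.lid k V) (by
    intro h y
    obtain ⟨x, rfl⟩ := (tensorEquiv _ V).surjective y
    induction x using TensorProduct.induction_on with
    | zero => simp
    | tmul c v =>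
      obtain ⟨c, rfl⟩ := (unitEquiv k H).surjective c
      rw [smul_tensorEquiv_tmul _ V h _ v (Coalgebra.Repr.arbitrary k h)]
      have h1 := congrArg (fun y => y • c • v)
        (Coalgebra.sum_counit_smul (Coalgebra.Repr.arbitrary k h))
      simp only [Finset.sum_smul] at h1
      simp only [LinearEquiv.trans_apply, LinearEquiv.symm_apply_apply, map_sum,
        TensorProduct.congr_tmul, TensorProduct.lid_tmul, smul_unitEquiv, LinearEquiv.refl_apply]
      rw [← h1]
      refine Finset.sum_congr rfl fun i _ => ?_
      rw [mul_smul, smul_assoc, smul_comm c]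
    | add x y hx hy => simp only [map_add, smul_add, hx, hy])

@[simp] lemma leftUnitor_tmul (V : FDMod k H) (c : k) (v : V) :
    leftUnitor V (tensorEquiv _ V (unitEquiv k H c ⊗ₜ v)) = c • v := by
  simp [leftUnitor]

@[simp] lemma leftUnitor_symm_apply (V : FDMod k H) (v : V) :
    (leftUnitor V).symm v = tensorEquiv _ V (unitEquiv k H 1 ⊗ₜ v) := by
  rw [LinearEquiv.symm_apply_eq, leftUnitor_tmul, one_smul]

/-- The right unitor `V ⊗ 1 ≅ V`. -/
def rightUnitor (V : FDMod k H) : tensor V (unit k H) ≃ₗ[H] V :=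
  mkEquiv ((tensorEquiv V (unit k H)).symm ≪≫ₗ
      TensorProduct.congr (LinearEquiv.refl k V) (unitEquiv k H).symm ≪≫ₗ
      TensorProduct.rid k V) (by
    intro h y
    obtain ⟨x, rfl⟩ := (tensorEquiv V _).surjective y
    induction x using TensorProduct.induction_on with
    | zero => simp
    | tmul v c =>
      obtain ⟨c, rfl⟩ := (unitEquiv k H).surjective c
      rw [smul_tensorEquiv_tmul V _ h v _ (Coalgebra.Repr.arbitrary k h)]
      have h1 := congrArg (fun y => (TensorProduct.rid k H y) • c • v)
        (Coalgebra.sum_tmul_counit_eq (Coalgebra.Repr.arbitrary k h))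
      simp only [map_sum, TensorProduct.rid_tmul, Finset.sum_smul, one_smul] at h1
      simp only [LinearEquiv.trans_apply, LinearEquiv.symm_apply_apply, map_sum,
        TensorProduct.congr_tmul, TensorProduct.rid_tmul, smul_unitEquiv, LinearEquiv.refl_apply]
      rw [← h1]
      refine Finset.sum_congr rfl fun i _ => ?_
      rw [mul_smul, smul_assoc, smul_comm c]
    | add x y hx hy => simp only [map_add, smul_add, hx, hy])

@[simp] lemma rightUnitor_tmul (V : FDMod k H) (c : k) (v : V) :
    rightUnitor V (tensorEquiv V _ (v ⊗ₜ unitEquiv k H c)) = c • v := by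
  simp [rightUnitor]

@[simp] lemma rightUnitor_symm_apply (V : FDMod k H) (v : V) :
    (rightUnitor V).symm v = tensorEquiv V _ (v ⊗ₜ unitEquiv k H 1) := by
  rw [LinearEquiv.symm_apply_eq, rightUnitor_tmul, one_smul]

/-- The associator `(V ⊗ W) ⊗ X ≅ V ⊗ (W ⊗ X)`. -/
def assoc (V W X : FDMod k H) : tensor (tensor V W) X ≃ₗ[H] tensor V (tensor W X) :=
  mkEquiv ((tensorEquiv (tensor V W) X).symm ≪≫ₗ
      TensorProduct.congr (tensorEquiv V W).symm (LinearEquiv.refl k X) ≪≫ₗ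
      TensorProduct.assoc k V W X ≪≫ₗ
      TensorProduct.congr (LinearEquiv.refl k V) (tensorEquiv W X) ≪≫ₗ
      tensorEquiv V (tensor W X)) (by
    intro h y
    obtain ⟨z, rfl⟩ := (tensorEquiv _ _).surjective y
    induction z using TensorProduct.induction_on with
    | zero => simp
    | add x y hx hy => simp only [map_add, smul_add, hx, hy]
    | tmul t x =>
      obtain ⟨t, rfl⟩ := (tensorEquiv V W).surjective t
      induction t using TensorProduct.induction_on with
      | zero => simp
      | add t t' ht ht' => simp only [map_add, smul_add, TensorProduct.add_tmul, ht, ht']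
      | tmul v w =>
        let r := Coalgebra.Repr.arbitrary k h
        have key := Coalgebra.sum_tmul_tmul_eq r
          (fun i => Coalgebra.Repr.arbitrary k (r.left i))
          (fun i => Coalgebra.Repr.arbitrary k (r.right i))
        replace key := congrArg (TensorProduct.map ((LinearMap.toSpanSingleton H V v).restrictScalars k)
          (TensorProduct.map ((LinearMap.toSpanSingleton H W w).restrictScalars k)
            ((LinearMap.toSpanSingleton H X x).restrictScalars k))) key
        replace key := congrArg (TensorProduct.congr (LinearEquiv.refl k V) (tensorEquiv W X)) key
        simp only [map_sum, TensorProduct.map_tmul, LinearMap.restrictScalars_apply,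
          LinearMap.toSpanSingleton_apply, TensorProduct.congr_tmul, LinearEquiv.refl_apply] at key
        rw [smul_tensorEquiv_tmul _ _ h _ x r]
        simp only [LinearEquiv.trans_apply, LinearEquiv.symm_apply_apply,
          TensorProduct.congr_tmul, LinearEquiv.refl_apply, TensorProduct.assoc_tmul]
        rw [smul_tensorEquiv_tmul _ _ h v _ r]
        simp only [smul_tensorEquiv_tmul V W (r.left _) v w (Coalgebra.Repr.arbitrary k _),
          smul_tensorEquiv_tmul W X (r.right _) w x (Coalgebra.Repr.arbitrary k _),
          map_sum, TensorProduct.sum_tmul, TensorProduct.tmul_sum, TensorProduct.congr_tmul,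
          LinearEquiv.symm_apply_apply, LinearEquiv.refl_apply, TensorProduct.assoc_tmul]
        simpa only [map_sum] using congrArg (tensorEquiv V (tensor W X)) key)

@[simp] lemma assoc_tmul (V W X : FDMod k H) (v : V) (w : W) (x : X) :
    assoc V W X (tensorEquiv _ _ (tensorEquiv V W (v ⊗ₜ w) ⊗ₜ x)) =
      tensorEquiv _ _ (v ⊗ₜ tensorEquiv W X (w ⊗ₜ x)) := by
  simp [assoc]

@[simp] lemma assoc_symm_tmul (V W X : FDMod k H) (v : V) (w : W) (x : X) :
    (assoc V W X).symm (tensorEquiv _ _ (v ⊗ₜ tensorEquiv W X (w ⊗ₜ x))) =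
      tensorEquiv _ _ (tensorEquiv V W (v ⊗ₜ w) ⊗ₜ x) := by
  rw [LinearEquiv.symm_apply_eq, assoc_tmul]

/-- The evaluation `ev_V : V^* ⊗ V → 1`, `φ ⊗ v ↦ φ(v)`. -/
def ev (V : FDMod k H) : tensor (dual V) V →ₗ[H] unit k H :=
  mkTensorHom ((unitEquiv k H).toLinearMap ∘ₗ contractLeft k V ∘ₗ
      (TensorProduct.congr (dualEquiv V).symm (LinearEquiv.refl k V)).toLinearMap) (by
    intro h φ v
    obtain ⟨φ, rfl⟩ := (dualEquiv V).surjective φ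
    have h1 := congrArg (fun y => φ (y • v))
      (HopfAlgebra.sum_antipode_mul_eq_smul (Coalgebra.Repr.arbitrary k h))
    simp only [Finset.sum_smul, map_sum, mul_smul, smul_assoc, one_smul, map_smul] at h1
    simpa [smul_dualEquiv, smul_unitEquiv, ← map_sum] using h1)

@[simp] lemma ev_tmul (V : FDMod k H) (φ : Module.Dual k V) (v : V) :
    ev V (tensorEquiv _ V (dualEquiv V φ ⊗ₜ v)) = unitEquiv k H (φ v) := by
  simp [ev]

lemma dualTensorHom_map (V : FDMod k H) (A B : Module.End k V)
    (x : Module.Dual k V ⊗[k] V) :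
    dualTensorHom k V V (TensorProduct.map B.dualMap A x) = A ∘ₗ dualTensorHom k V V x ∘ₗ B := by
  induction x using TensorProduct.induction_on with
  | zero => simp
  | tmul φ v => ext w; simp
  | add x y hx hy => simp only [map_add, hx, hy, LinearMap.comp_add, LinearMap.add_comp]

lemma dualTensorHom_injective (V : FDMod k H) : Function.Injective (dualTensorHom k V V) := by
  classical
  have h := (dualTensorHomEquivOfBasis (N := V) (Module.Basis.ofVectorSpace k V)).injective
  rwa [coe_dualTensorHomEquivOfBasis] at h

lemma dualTensorHom_sum_basis (V : FDMod k H) {ι : Type*} [Fintype ι] (b : Module.Basis ι k V) :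
    dualTensorHom k V V (∑ i, b.coord i ⊗ₜ b i) = LinearMap.id := by
  ext v
  simp [b.sum_repr]

lemma dualTensorHom_coevaluation (V : FDMod k H) :
    dualTensorHom k V V (TensorProduct.comm k _ _ (coevaluation k V 1)) = LinearMap.id := by
  rw [coevaluation_apply_one]
  simpa only [map_sum, TensorProduct.comm_tmul] using
    dualTensorHom_sum_basis V (Module.Basis.ofVectorSpace k V)

lemma comm_coevaluation (V : FDMod k H) {ι : Type*} [Fintype ι] (b : Module.Basis ι k V) :
    TensorProduct.comm k _ _ (coevaluation k V 1) = ∑ i, b.coord i ⊗ₜ b i :=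
  dualTensorHom_injective V (by rw [dualTensorHom_coevaluation, dualTensorHom_sum_basis])

lemma coevaluation_eq (V : FDMod k H) {ι : Type*} [Fintype ι] (b : Module.Basis ι k V) :
    coevaluation k V 1 = ∑ i, b i ⊗ₜ b.coord i := by
  apply (TensorProduct.comm k _ _).injective
  rw [comm_coevaluation V b]; simp

lemma act_dual_comp (V : FDMod k H) (h : H) :
    (dual V).act h ∘ₗ (dualEquiv V).toLinearMap =
      (dualEquiv V).toLinearMap ∘ₗ (V.act (HopfAlgebra.antipode k h)).dualMap := rfl

/-- The coevaluation `coev_V : 1 → V ⊗ V^*`, `1 ↦ ∑ vᵢ ⊗ vᵢ^*`. -/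
def coev (V : FDMod k H) : unit k H →ₗ[H] tensor V (dual V) :=
  mkHom ((tensorEquiv V (dual V)).toLinearMap ∘ₗ
      (TensorProduct.congr (LinearEquiv.refl k V) (dualEquiv V)).toLinearMap ∘ₗ
      coevaluation k V ∘ₗ (unitEquiv k H).symm.toLinearMap) (by
    intro h c
    obtain ⟨c, rfl⟩ := (unitEquiv k H).surjective c
    let r := Coalgebra.Repr.arbitrary k h
    have key : Coalgebra.counit (R := k) h • coevaluation k V 1 =
        ∑ i ∈ r.index, TensorProduct.map (V.act (r.left i))
          (V.act (HopfAlgebra.antipode k (r.right i))).dualMap (coevaluation k V 1) := by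
      apply (TensorProduct.comm k _ _).injective
      apply dualTensorHom_injective
      simp only [map_smul, map_sum, ← TensorProduct.map_comm, dualTensorHom_map,
        dualTensorHom_coevaluation]
      have h2 := congrArg V.act (HopfAlgebra.sum_mul_antipode_eq_smul r)
      simp only [map_sum, map_mul, map_smul, map_one] at h2
      exact h2.symm
    have hc : ∀ c : k, coevaluation k V c = c • coevaluation k V 1 := fun c => by
      rw [← map_smul, smul_eq_mul, mul_one]
    simp only [smul_unitEquiv, LinearMap.comp_apply, LinearEquiv.coe_coe,
      LinearEquiv.symm_apply_apply]
    rw [hc, hc c, mul_comm, mul_smul, key, smul_tensorEquiv V _ h _ r]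
    simp only [map_smul, map_sum, Finset.smul_sum]
    refine Finset.sum_congr rfl fun i _ => ?_
    rw [← LinearEquiv.coe_toLinearMap (TensorProduct.congr _ _), TensorProduct.toLinearMap_congr,
      ← LinearMap.comp_apply (TensorProduct.map _ _), ← LinearMap.comp_apply (TensorProduct.map _ _),
      ← TensorProduct.map_comp, ← TensorProduct.map_comp, act_dual_comp]
    rfl)

lemma coev_apply (V : FDMod k H) {ι : Type*} [Fintype ι] (b : Module.Basis ι k V) :
    coev V (unitEquiv k H 1) = ∑ i, tensorEquiv V (dual V) (b i ⊗ₜ dualEquiv V (b.coord i)) := by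
  simp [coev, coevaluation_eq V b]

/-- The right evaluation `V ⊗ V^* → 1`, `v ⊗ φ ↦ φ(g v)`. -/
def evTilde (p : Pivot k H) (V : FDMod k H) : tensor V (dual V) →ₗ[H] unit k H :=
  mkTensorHom ((unitEquiv k H).toLinearMap ∘ₗ contractLeft k V ∘ₗ
      TensorProduct.map (dualEquiv V).symm.toLinearMap (V.act (p.g : H)) ∘ₗ
      (TensorProduct.comm k V (dual V)).toLinearMap) (by
    intro h v φ
    obtain ⟨φ, rfl⟩ := (dualEquiv V).surjective φ
    let r := Coalgebra.Repr.arbitrary k h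
    have h1 : ∑ i ∈ r.index, HopfAlgebra.antipode k (r.right i) * (p.g : H) * r.left i =
        Coalgebra.counit (R := k) h • (p.g : H) := by
      have h2 := congrArg (HopfAlgebra.antipode k) (HopfAlgebra.sum_antipode_mul_eq_smul r)
      simp only [map_sum, HopfAlgebra.antipode_mul_antidistrib, p.antipode_antipode, map_smul,
        HopfAlgebra.antipode_one] at h2
      have h3 := congrArg (fun y => y * (p.g : H)) h2
      simp only [Finset.sum_mul, smul_mul_assoc, one_mul, GroupLike.val_inv] at h3
      rw [← h3]
      refine Finset.sum_congr rfl fun i _ => ?_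
      simp only [mul_assoc, p.g.isGroupLikeElem_val.antipode_mul_cancel, mul_one]
    have h4 := congrArg (fun y => φ (y • v)) h1
    simp only [Finset.sum_smul, map_sum, mul_smul, smul_assoc, map_smul] at h4
    simpa [smul_dualEquiv, smul_unitEquiv, ← map_sum] using h4)

@[simp] lemma evTilde_tmul (p : Pivot k H) (V : FDMod k H) (v : V) (φ : Module.Dual k V) :
    evTilde p V (tensorEquiv V _ (v ⊗ₜ dualEquiv V φ)) = unitEquiv k H (φ ((p.g : H) • v)) := by
  simp [evTilde]

/-- The right coevaluation `1 → V^* ⊗ V`, `1 ↦ ∑ vᵢ^* ⊗ g⁻¹ vᵢ`. -/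
def coevTilde (p : Pivot k H) (V : FDMod k H) : unit k H →ₗ[H] tensor (dual V) V :=
  mkHom ((tensorEquiv (dual V) V).toLinearMap ∘ₗ
      TensorProduct.map (dualEquiv V).toLinearMap (V.act ((p.g⁻¹ : GroupLike k H) : H)) ∘ₗ
      (TensorProduct.comm k V (Module.Dual k V)).toLinearMap ∘ₗ
      coevaluation k V ∘ₗ (unitEquiv k H).symm.toLinearMap) (by
    intro h c
    obtain ⟨c, rfl⟩ := (unitEquiv k H).surjective c
    let r := Coalgebra.Repr.arbitrary k h
    let g' : H := ((p.g⁻¹ : GroupLike k H) : H)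
    let z := TensorProduct.comm k V (Module.Dual k V) (coevaluation k V 1)
    have h1 : ∑ i ∈ r.index, r.right i * g' * HopfAlgebra.antipode k (r.left i) =
        Coalgebra.counit (R := k) h • g' := by
      have h2 := congrArg (HopfAlgebra.antipode k) (HopfAlgebra.sum_mul_antipode_eq_smul r)
      simp only [map_sum, HopfAlgebra.antipode_mul_antidistrib, p.antipode_antipode, map_smul,
        HopfAlgebra.antipode_one] at h2
      have h3 := congrArg (fun y => g' * y) h2
      simp only [Finset.mul_sum, mul_smul_comm, mul_one] at h3
      rw [← h3]
      refine Finset.sum_congr rfl fun i _ => ?_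
      simp only [g', GroupLike.val_inv, ← mul_assoc,
        p.g.isGroupLikeElem_val.antipode_mul_cancel, one_mul]
    have key : Coalgebra.counit (R := k) h •
          TensorProduct.map LinearMap.id (V.act g') z =
        ∑ i ∈ r.index, TensorProduct.map (V.act (HopfAlgebra.antipode k (r.left i))).dualMap
          (V.act (r.right i)) (TensorProduct.map LinearMap.id (V.act g') z) := by
      apply dualTensorHom_injective
      have hid : (LinearMap.id : Module.Dual k V →ₗ[k] Module.Dual k V) =
        (LinearMap.id : Module.End k V).dualMap := rfl
      simp only [hid, map_smul, map_sum, dualTensorHom_map, z, dualTensorHom_coevaluation]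
      have h2 := congrArg V.act h1
      simp only [map_sum, map_mul, map_smul] at h2
      exact h2.symm
    have hz : ∀ w, TensorProduct.map (dualEquiv V).toLinearMap (V.act g') w =
        TensorProduct.map (dualEquiv V).toLinearMap LinearMap.id
          (TensorProduct.map LinearMap.id (V.act g') w) := fun w => by
      rw [← LinearMap.comp_apply, ← TensorProduct.map_comp]; rfl
    have hc : ∀ c : k, coevaluation k V c = c • coevaluation k V 1 := fun c => by
      rw [← map_smul, smul_eq_mul, mul_one]
    simp only [smul_unitEquiv, LinearMap.comp_apply, LinearEquiv.coe_coe,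
      LinearEquiv.symm_apply_apply]
    rw [hc, hc c, mul_comm, mul_smul, smul_tensorEquiv _ V h _ r]
    change tensorEquiv _ V (TensorProduct.map _ (V.act g') _) =
      tensorEquiv _ V (∑ i ∈ r.index, TensorProduct.map _ _ (TensorProduct.map _ (V.act g') _))
    simp only [map_smul, ← Finset.smul_sum]
    rw [← map_smul (tensorEquiv (dual V) V)]
    refine congrArg (c • tensorEquiv (dual V) V ·) ?_
    change _ • TensorProduct.map _ (V.act g') z = ∑ i ∈ r.index,
      TensorProduct.map _ _ (TensorProduct.map _ (V.act g') z)
    rw [hz z, ← map_smul, key, map_sum]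
    refine Finset.sum_congr rfl fun i _ => ?_
    rw [← LinearMap.comp_apply, ← LinearMap.comp_apply (TensorProduct.map ((dual V).act _) _),
      ← TensorProduct.map_comp, ← TensorProduct.map_comp, act_dual_comp]
    rfl)

lemma coevTilde_apply (p : Pivot k H) (V : FDMod k H) {ι : Type*} [Fintype ι]
    (b : Module.Basis ι k V) :
    coevTilde p V (unitEquiv k H 1) = ∑ i, tensorEquiv (dual V) V
      (dualEquiv V (b.coord i) ⊗ₜ (((p.g⁻¹ : GroupLike k H) : H) • b i)) := by
  simp only [coevTilde, mkHom_apply, LinearMap.comp_apply, LinearEquiv.coe_coe,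
    LinearEquiv.symm_apply_apply, comm_coevaluation V b, map_sum, TensorProduct.map_tmul,
    act_apply]

/-- The right partial trace of `f ∈ End(W ⊗ V)`:
`(id_W ⊗ evTilde_V) ∘ (f ⊗ id_{V^*}) ∘ (id_W ⊗ coev_V) ∈ End(W)`. -/
def rightPartialTrace (p : Pivot k H) (W V : FDMod k H) (f : tensor W V →ₗ[H] tensor W V) :
    W →ₗ[H] W :=
  (rightUnitor W).toLinearMap ∘ₗ tensorHom LinearMap.id (evTilde p V) ∘ₗ
    (assoc W V (dual V)).toLinearMap ∘ₗ tensorHom f LinearMap.id ∘ₗ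
    (assoc W V (dual V)).symm.toLinearMap ∘ₗ tensorHom LinearMap.id (coev V) ∘ₗ
    (rightUnitor W).symm.toLinearMap

/-- The left partial trace of `f ∈ End(W ⊗ V)`:
`(ev_W ⊗ id_V) ∘ (id_{W^*} ⊗ f) ∘ (coevTilde_W ⊗ id_V) ∈ End(V)`. -/
def leftPartialTrace (p : Pivot k H) (W V : FDMod k H) (f : tensor W V →ₗ[H] tensor W V) :
    V →ₗ[H] V :=
  (leftUnitor V).toLinearMap ∘ₗ tensorHom (ev W) LinearMap.id ∘ₗ
    (assoc (dual W) W V).symm.toLinearMap ∘ₗ tensorHom LinearMap.id f ∘ₗ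
    (assoc (dual W) W V).toLinearMap ∘ₗ tensorHom (coevTilde p W) LinearMap.id ∘ₗ
    (leftUnitor V).symm.toLinearMap

lemma tensor_hom_ext {V W X : FDMod k H} {f g : tensor V W →ₗ[H] X}
    (h : ∀ v w, f (tensorEquiv V W (v ⊗ₜ w)) = g (tensorEquiv V W (v ⊗ₜ w))) : f = g := by
  ext y
  obtain ⟨x, rfl⟩ := (tensorEquiv V W).surjective y
  induction x using TensorProduct.induction_on with
  | zero => simp
  | tmul v w => exact h v w
  | add x y hx hy => simp only [map_add, hx, hy]

lemma tensorHom_surjective {V V' W W' : FDMod k H} {f : V →ₗ[H] V'} {g : W →ₗ[H] W'}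
    (hf : Function.Surjective f) (hg : Function.Surjective g) :
    Function.Surjective (tensorHom f g) := by
  intro y
  obtain ⟨x, rfl⟩ := (tensorEquiv V' W').surjective y
  induction x using TensorProduct.induction_on with
  | zero => exact ⟨0, by simp⟩
  | tmul v w =>
    obtain ⟨v, rfl⟩ := hf v
    obtain ⟨w, rfl⟩ := hg w
    exact ⟨_, tensorHom_tmul f g v w⟩
  | add x y hx hy =>
    obtain ⟨a, ha⟩ := hx
    obtain ⟨b, hb⟩ := hy
    exact ⟨a + b, by rw [map_add, map_add, ha, hb]⟩

/-- If every surjection onto `Q` from a finite-dimensional module splits, `Q` is projective. -/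
lemma projective_of_split [FiniteDimensional k H] (Q : FDMod k H)
    (h : ∀ (X : FDMod k H) (e : X →ₗ[H] Q), Function.Surjective e →
      ∃ s : Q →ₗ[H] X, e ∘ₗ s = LinearMap.id) : Module.Projective H Q := by
  have : Module.Finite H Q := Module.Finite.of_restrictScalars_finite k H Q
  obtain ⟨n, e, he⟩ := Module.Finite.exists_fin' H Q
  let X : FDMod k H := { carrier := Fin n → H }
  obtain ⟨s, hs⟩ := h X e he
  exact Module.Projective.of_split (M := Fin n → H) s e hs

/-- The tensor product of a projective module with any module is projective. -/
lemma projective_tensor_left [FiniteDimensional k H] (P V : FDMod k H) [Module.Projective H P] :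
    Module.Projective H (tensor P V) := by
  refine projective_of_split _ fun X e he => ?_
  let α : P →ₗ[H] tensor (tensor P V) (dual V) :=
    (assoc P V (dual V)).symm.toLinearMap ∘ₗ tensorHom LinearMap.id (coev V) ∘ₗ
      (rightUnitor P).symm.toLinearMap
  let β : (Y : FDMod k H) → tensor (tensor Y (dual V)) V →ₗ[H] Y := fun Y =>
    (rightUnitor Y).toLinearMap ∘ₗ tensorHom LinearMap.id (ev V) ∘ₗ
      (assoc Y (dual V) V).toLinearMap
  obtain ⟨l, hl⟩ := Module.projective_lifting_property
    (tensorHom e (LinearMap.id : dual V →ₗ[H] dual V)) α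
    (tensorHom_surjective he Function.surjective_id)
  have hβ : e ∘ₗ β X = β (tensor P V) ∘ₗ
      tensorHom (tensorHom e (LinearMap.id : dual V →ₗ[H] dual V)) LinearMap.id := by
    refine tensor_hom_ext fun t v => ?_
    obtain ⟨t, rfl⟩ := (tensorEquiv _ _).surjective t
    induction t using TensorProduct.induction_on with
    | zero => simp
    | add x y hx hy => simp only [map_add, TensorProduct.add_tmul, hx, hy]
    | tmul x φ =>
      obtain ⟨φ, rfl⟩ := (dualEquiv V).surjective φ
      simp [β]
  refine ⟨β X ∘ₗ tensorHom l LinearMap.id, ?_⟩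
  rw [← LinearMap.comp_assoc, hβ, LinearMap.comp_assoc]
  refine tensor_hom_ext fun x v => ?_
  let b := Module.Basis.ofVectorSpace k V
  have h1 : tensorHom e (LinearMap.id : dual V →ₗ[H] dual V) (l x) = α x := LinearMap.congr_fun hl x
  have h2 : ∑ i, b.repr v i • tensorEquiv P V (x ⊗ₜ[k] b i) = tensorEquiv P V (x ⊗ₜ[k] v) := by
    simp only [← map_smul, ← map_sum, ← TensorProduct.tmul_smul, ← TensorProduct.tmul_sum,
      b.sum_repr]
  simpa [h1, α, coev_apply V b, β, TensorProduct.tmul_sum, TensorProduct.sum_tmul] using h2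

/-- The tensor product of any module with a projective module is projective. -/
lemma projective_tensor_right [FiniteDimensional k H] (p : Pivot k H) (V P : FDMod k H)
    [Module.Projective H P] : Module.Projective H (tensor V P) := by
  refine projective_of_split _ fun X e he => ?_
  let α : P →ₗ[H] tensor (dual V) (tensor V P) :=
    (assoc (dual V) V P).toLinearMap ∘ₗ tensorHom (coevTilde p V) LinearMap.id ∘ₗ
      (leftUnitor P).symm.toLinearMap
  let β : (Y : FDMod k H) → tensor V (tensor (dual V) Y) →ₗ[H] Y := fun Y =>
    (leftUnitor Y).toLinearMap ∘ₗ tensorHom (evTilde p V) LinearMap.id ∘ₗ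
      (assoc V (dual V) Y).symm.toLinearMap
  obtain ⟨l, hl⟩ := Module.projective_lifting_property
    (tensorHom (LinearMap.id : dual V →ₗ[H] dual V) e) α
    (tensorHom_surjective Function.surjective_id he)
  have hβ : e ∘ₗ β X = β (tensor V P) ∘ₗ
      tensorHom LinearMap.id (tensorHom (LinearMap.id : dual V →ₗ[H] dual V) e) := by
    refine tensor_hom_ext fun v t => ?_
    obtain ⟨t, rfl⟩ := (tensorEquiv _ _).surjective t
    induction t using TensorProduct.induction_on with
    | zero => simp
    | add x y hx hy => simp only [map_add, TensorProduct.tmul_add, hx, hy]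
    | tmul φ x =>
      obtain ⟨φ, rfl⟩ := (dualEquiv V).surjective φ
      simp [β]
  refine ⟨β X ∘ₗ tensorHom LinearMap.id l, ?_⟩
  rw [← LinearMap.comp_assoc, hβ, LinearMap.comp_assoc]
  refine tensor_hom_ext fun v x => ?_
  let b := Module.Basis.ofVectorSpace k V
  have h1 : tensorHom (LinearMap.id : dual V →ₗ[H] dual V) e (l x) = α x := LinearMap.congr_fun hl x
  have hb := congrArg (fun y => ((p.g⁻¹ : GroupLike k H) : H) • y) (b.sum_repr ((p.g : H) • v))
  simp only [Finset.smul_sum, smul_comm _ (b.repr _ _), ← mul_smul, GroupLike.val_inv,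
    p.g.isGroupLikeElem_val.antipode_mul_cancel, one_smul] at hb
  have h2 : ∑ i, b.repr ((p.g : H) • v) i •
      tensorEquiv V P ((HopfAlgebra.antipode k (p.g : H) • b i) ⊗ₜ[k] x) =
        tensorEquiv V P (v ⊗ₜ[k] x) := by
    simp only [← map_smul, ← map_sum, TensorProduct.smul_tmul', ← TensorProduct.sum_tmul, hb]
  simpa [h1, α, coevTilde_apply p V b, β, TensorProduct.tmul_sum, TensorProduct.sum_tmul] using h2

end Monoidal

end FDMod

/-! ### Modified traces -/

section Traces

variable (k H : Type u) [Field k] [Ring H] [HopfAlgebra k H] [FiniteDimensional k H]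

/-- The objects of `H`-pmod: finite-dimensional projective `H`-modules. -/
abbrev ProjMod : Type (u + 1) := {P : FDMod k H // Module.Projective H P}

/-- The regular module as an object of `H`-pmod. -/
def regularProj : ProjMod k H :=
  ⟨FDMod.regular k H, inferInstanceAs (Module.Projective H H)⟩

/-- Families of linear forms `t_P : End_H(P) → k`, with `P` ranging over `H`-pmod. -/
abbrev TraceFamily : Type (u + 1) := (P : ProjMod k H) → ((P.1 →ₗ[H] P.1) →ₗ[k] k)

variable {k H}

/-- `P ⊗ V` as an object of `H`-pmod. -/
def ProjMod.tensorRight (P : ProjMod k H) (V : FDMod k H) : ProjMod k H :=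
  ⟨FDMod.tensor P.1 V, haveI := P.2; FDMod.projective_tensor_left P.1 V⟩

/-- `V ⊗ P` as an object of `H`-pmod. -/
def ProjMod.tensorLeft (p : Pivot k H) (V : FDMod k H) (P : ProjMod k H) : ProjMod k H :=
  ⟨FDMod.tensor V P.1, haveI := P.2; FDMod.projective_tensor_right p V P.1⟩

/-- Cyclicity: `t_P(g ∘ f) = t_{P'}(f ∘ g)` for `f : P → P'` and `g : P' → P`. -/
def IsCyclic (t : TraceFamily k H) : Prop :=
  ∀ (P P' : ProjMod k H) (f : P.1 →ₗ[H] P'.1) (g : P'.1 →ₗ[H] P.1),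
    t P (g ∘ₗ f) = t P' (f ∘ₗ g)

/-- Right partial trace property: `t_{P ⊗ V}(f) = t_P(tr^r_V(f))`. -/
def HasRightPartialTrace (p : Pivot k H) (t : TraceFamily k H) : Prop :=
  ∀ (P : ProjMod k H) (V : FDMod k H) (f : FDMod.tensor P.1 V →ₗ[H] FDMod.tensor P.1 V),
    t (P.tensorRight V) f = t P (FDMod.rightPartialTrace p P.1 V f)

/-- Left partial trace property: `t_{V ⊗ P}(f) = t_P(tr^l_V(f))`. -/
def HasLeftPartialTrace (p : Pivot k H) (t : TraceFamily k H) : Prop :=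
  ∀ (P : ProjMod k H) (V : FDMod k H) (f : FDMod.tensor V P.1 →ₗ[H] FDMod.tensor V P.1),
    t (P.tensorLeft p V) f = t P (FDMod.leftPartialTrace p V P.1 f)

/-- The space of right modified traces on `H`-pmod. -/
def rightModifiedTraces (p : Pivot k H) : Submodule k (TraceFamily k H) where
  carrier := {t | IsCyclic t ∧ HasRightPartialTrace p t}
  zero_mem' := ⟨fun _ _ _ _ => rfl, fun _ _ _ => rfl⟩
  add_mem' := fun hs ht =>
    ⟨fun P P' f g => congrArg₂ (· + ·) (hs.1 P P' f g) (ht.1 P P' f g),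
      fun P V f => congrArg₂ (· + ·) (hs.2 P V f) (ht.2 P V f)⟩
  smul_mem' := fun c _ ht =>
    ⟨fun P P' f g => congrArg (c • ·) (ht.1 P P' f g),
      fun P V f => congrArg (c • ·) (ht.2 P V f)⟩

/-- The space of left modified traces on `H`-pmod. -/
def leftModifiedTraces (p : Pivot k H) : Submodule k (TraceFamily k H) where
  carrier := {t | IsCyclic t ∧ HasLeftPartialTrace p t}
  zero_mem' := ⟨fun _ _ _ _ => rfl, fun _ _ _ => rfl⟩
  add_mem' := fun hs ht =>
    ⟨fun P P' f g => congrArg₂ (· + ·) (hs.1 P P' f g) (ht.1 P P' f g),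
      fun P V f => congrArg₂ (· + ·) (hs.2 P V f) (ht.2 P V f)⟩
  smul_mem' := fun c _ ht =>
    ⟨fun P P' f g => congrArg (c • ·) (ht.1 P P' f g),
      fun P V f => congrArg (c • ·) (ht.2 P V f)⟩

/-- Non-degeneracy: for all projective `P` and all `M`, the pairing
`Hom_H(M, P) × Hom_H(P, M) → k`, `(a, b) ↦ t_P(a ∘ b)`, is non-degenerate on both sides. -/
def IsNondegenerate (t : TraceFamily k H) : Prop :=
  ∀ (P : ProjMod k H) (M : FDMod k H),
    (∀ a : M →ₗ[H] P.1, (∀ b : P.1 →ₗ[H] M, t P (a ∘ₗ b) = 0) → a = 0) ∧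
    (∀ b : P.1 →ₗ[H] M, (∀ a : M →ₗ[H] P.1, t P (a ∘ₗ b) = 0) → b = 0)

end Traces

end HopfTrace
end

/-!
A cyclic family of traces on the projective modules is determined by the form `λ` on `H` with
`t_H(f) = λ(f(1))`, because every projective module is a retract of a free one, and every symmetric
form arises in this way (`symTrace`, `traceForm_symTrace`). The partial trace property is a
condition on `λ` alone. The module `H ⊗ V` is free on the vectors `1 ⊗ vᵢ`, with coordinate
morphisms `x ⊗ v ↦ x₁ vᵢ^*(S(x₂) v)` (`sum_spanHom_comp_mateR`), so that for `f ∈ End_H(H ⊗ V)` with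
`f(1 ⊗ vᵢ) = x ⊗ v` one compares `λ(x₁) vᵢ^*(S(x₂) v)` with `λ(x) vᵢ^*(g v)`. These agree for all
`V` and `f` exactly when `λ(x₁) x₂ = λ(x) g⁻¹`, which says that `λ` is a symmetrised right integral
(`mem_symRightIntegrals`). On the left the condition is `x₁ λ(x₂) = λ(x) g`, and `λ ↦ λ ∘ S`
exchanges the two (`map_symRightIntegrals`). If `λ` is moreover a Frobenius form, the trace is
non-degenerate, since composition with `λ` identifies `Hom_H(M, H)` with `M^*`.

What remains is the theory of integrals of a finite-dimensional Hopf algebra whose `S²` is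
conjugation by a group-like element. It rests on the identity `μ(a₁ b) a₂ = S(b₂) μ(a b₁)` for right
integrals `μ` (`hitL_comp_mulRight`).

* The elements `a` with `μ(a H) = 0` form a right ideal that is stable under all maps
  `x ↦ x₁ ψ(x₂)`, and such an ideal is zero or contains `1`. Hence a non-zero right integral is a
  Frobenius form (`eq_zero_of_rightIntegral`), and the identity then shows that right integrals are
  unique up to scalars (`exists_eq_smul_of_rightIntegral`).
* For each form `φ` the trace of `y ↦ φ(w₁) w₂`, where `w = h S⁻²(y)`, is a right integral in `h`,
  and these integrals do not all vanish; both facts follow from the cyclicity of the trace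
  (`traceIntegral_mem`, `sum_traceIntegral`).
* If `H` is unimodular and `c` is the cointegral with `μ(c) = 1`, the identity says that `c₁` and
  `S(c₂)` are dual bases for `μ` and that `S²(y) = μ(c₁ y) S(c₂)`. Therefore `μ(x y) = μ(S²(y) x)`
  (`rightIntegral_mul`), which makes the symmetrised integral symmetric.
-/

noncomputable section

namespace HopfTrace

open Coalgebra HopfAlgebra FDMod

/-! ### The actions of linear forms on a Hopf algebra -/

section Hits

variable {k H : Type u} [Field k] [Ring H] [HopfAlgebra k H]

/-- The map `x ↦ α(x₁) x₂`. -/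
def hitL (α : Module.Dual k H) : H →ₗ[k] H :=
  (TensorProduct.lid k H).toLinearMap ∘ₗ TensorProduct.map α LinearMap.id ∘ₗ comul

/-- The map `x ↦ x₁ α(x₂)`. -/
def hitR (α : Module.Dual k H) : H →ₗ[k] H :=
  (TensorProduct.rid k H).toLinearMap ∘ₗ TensorProduct.map LinearMap.id α ∘ₗ comul

lemma hitL_eq_sum (α : Module.Dual k H) {x : H} {ι : Type*} (r : Repr k x ι) :
    hitL α x = ∑ i ∈ r.index, α (r.left i) • r.right i := by
  simp [hitL, ← r.eq]

lemma hitR_eq_sum (α : Module.Dual k H) {x : H} {ι : Type*} (r : Repr k x ι) :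
    hitR α x = ∑ i ∈ r.index, α (r.right i) • r.left i := by
  simp [hitR, ← r.eq]

lemma apply_hitR (α β : Module.Dual k H) (x : H) : α (hitR β x) = β (hitL α x) := by
  simp only [hitL_eq_sum _ (ℛ k x), hitR_eq_sum _ (ℛ k x), map_sum, map_smul, smul_eq_mul, mul_comm]

@[simp] lemma hitL_counit (x : H) : hitL (counit : Module.Dual k H) x = x := by
  rw [hitL_eq_sum _ (ℛ k x), sum_counit_smul]

@[simp] lemma hitR_counit (x : H) : hitR (counit : Module.Dual k H) x = x := by
  exact (congrArg (TensorProduct.rid k H) (lTensor_counit_comul (R := k) x)).trans (by simp)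

@[simp] lemma counit_hitR (α : Module.Dual k H) (x : H) : counit (R := k) (hitR α x) = α x := by
  rw [apply_hitR, hitL_counit]

@[simp] lemma counit_hitL (α : Module.Dual k H) (x : H) : counit (R := k) (hitL α x) = α x := by
  rw [← apply_hitR, hitR_counit]

lemma hitL_hitR (α β : Module.Dual k H) (x : H) : hitL α (hitR β x) = hitR β (hitL α x) := by
  have := congrArg ((TensorProduct.lid k H).toLinearMap ∘ₗ TensorProduct.map α
    ((TensorProduct.rid k H).toLinearMap ∘ₗ TensorProduct.map LinearMap.id β))
    (sum_tmul_tmul_eq (ℛ k x) (fun i => ℛ k ((ℛ k x).left i)) (fun i => ℛ k ((ℛ k x).right i)))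
  rw [hitL_eq_sum _ (ℛ k x), hitR_eq_sum _ (ℛ k x)]
  simp only [map_sum, map_smul, hitL_eq_sum _ (ℛ k ((ℛ k x).left _)),
    hitR_eq_sum _ (ℛ k ((ℛ k x).right _)), Finset.smul_sum]
  simpa [smul_comm (β _)] using this

lemma hitR_hitR (α β : Module.Dual k H) (x : H) :
    hitR α (hitR β x) = hitR (α ∘ₗ hitR β) x := by
  have := congrArg ((TensorProduct.rid k H).toLinearMap ∘ₗ TensorProduct.map LinearMap.id
    ((TensorProduct.rid k k).toLinearMap ∘ₗ TensorProduct.map α β))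
    (sum_tmul_tmul_eq (ℛ k x) (fun i => ℛ k ((ℛ k x).left i)) (fun i => ℛ k ((ℛ k x).right i)))
  rw [hitR_eq_sum _ (ℛ k x), hitR_eq_sum _ (ℛ k x)]
  simp only [map_sum, map_smul, hitR_eq_sum _ (ℛ k ((ℛ k x).left _)), LinearMap.comp_apply,
    hitR_eq_sum _ (ℛ k ((ℛ k x).right _)), Finset.smul_sum, Finset.sum_smul]
  simpa [smul_smul] using this

lemma hitL_hitL (α β : Module.Dual k H) (x : H) :
    hitL α (hitL β x) = hitL (α ∘ₗ hitL β) x := by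
  have := congrArg ((TensorProduct.lid k H).toLinearMap ∘ₗ TensorProduct.map β
    ((TensorProduct.lid k H).toLinearMap ∘ₗ TensorProduct.map α LinearMap.id))
    (sum_tmul_tmul_eq (ℛ k x) (fun i => ℛ k ((ℛ k x).left i)) (fun i => ℛ k ((ℛ k x).right i)))
  rw [hitL_eq_sum _ (ℛ k x), hitL_eq_sum _ (ℛ k x)]
  simp only [map_sum, map_smul, hitL_eq_sum _ (ℛ k ((ℛ k x).left _)), LinearMap.comp_apply,
    hitL_eq_sum _ (ℛ k ((ℛ k x).right _)), Finset.smul_sum, Finset.sum_smul]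
  simpa [smul_smul, mul_comm] using this.symm

lemma sum_hitR_apply {ι : Type*} (s : Finset ι) (α : ι → Module.Dual k H) (x : H) :
    ∑ j ∈ s, hitR (α j) x = hitR (∑ j ∈ s, α j) x := by
  simp only [hitR_eq_sum _ (ℛ k x), LinearMap.sum_apply, Finset.sum_smul]
  exact Finset.sum_comm

lemma hitR_smul (c : k) (α : Module.Dual k H) (x : H) : hitR (c • α) x = c • hitR α x := by
  simp [hitR_eq_sum _ (ℛ k x), Finset.smul_sum, mul_smul]

lemma sum_coord_mul_apply {ι : Type*} [Fintype ι] (b : Module.Basis ι k H) (ψ : Module.Dual k H)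
    (x y : H) : ∑ j, b.coord j x * ψ (b j * y) = ψ (x * y) := by
  conv_rhs => rw [← b.sum_repr x]
  simp [Finset.sum_mul, -Module.Basis.sum_repr]

lemma hitL_mul (α : Module.Dual k H) (x y : H) {ι : Type*} (r : Repr k x ι) :
    hitL α (x * y) =
      ∑ i ∈ r.index, r.right i * hitL (α ∘ₗ LinearMap.mulLeft k (r.left i)) y := by
  simp only [hitL_eq_sum _ (r.mul (ℛ k y)), hitL_eq_sum _ (ℛ k y)]
  simp [Finset.sum_product, Finset.mul_sum]

lemma hitR_mul (α : Module.Dual k H) (x y : H) {ι : Type*} (r : Repr k x ι) :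
    hitR α (x * y) =
      ∑ i ∈ r.index, r.left i * hitR (α ∘ₗ LinearMap.mulLeft k (r.right i)) y := by
  simp only [hitR_eq_sum _ (r.mul (ℛ k y)), hitR_eq_sum _ (ℛ k y)]
  simp [Finset.sum_product, Finset.mul_sum]

lemma comul_groupLike_mul (g : GroupLike k H) {x : H} {ι : Type*} (r : Repr k x ι) :
    comul (R := k) ((g : H) * x) =
      ∑ i ∈ r.index, ((g : H) * r.left i) ⊗ₜ[k] ((g : H) * r.right i) := by
  rw [Bialgebra.comul_mul, g.isGroupLikeElem_val.comul_eq_tmul_self, ← r.eq]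
  simp [Finset.mul_sum]

lemma hitL_groupLike_mul (α : Module.Dual k H) (g : GroupLike k H) (x : H) :
    hitL α (g * x) = g * hitL (α ∘ₗ LinearMap.mulLeft k (g : H)) x := by
  simp only [hitL_eq_sum _ (ℛ k x)]
  simp [hitL, comul_groupLike_mul g (ℛ k x), Finset.mul_sum]

lemma hitR_groupLike_mul (α : Module.Dual k H) (g : GroupLike k H) (x : H) :
    hitR α (g * x) = g * hitR (α ∘ₗ LinearMap.mulLeft k (g : H)) x := by
  simp only [hitR_eq_sum _ (ℛ k x)]
  simp [hitR, comul_groupLike_mul g (ℛ k x), Finset.mul_sum]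

lemma hitR_mul_groupLike (α : Module.Dual k H) (g : GroupLike k H) (x : H) :
    hitR α (x * g) = hitR (α ∘ₗ LinearMap.mulRight k (g : H)) x * g := by
  simp only [hitR_eq_sum _ (ℛ k x)]
  have h : comul (R := k) (x * (g : H)) = ∑ i ∈ (ℛ k x).index,
      ((ℛ k x).left i * (g : H)) ⊗ₜ[k] ((ℛ k x).right i * (g : H)) := by
    rw [Bialgebra.comul_mul, g.isGroupLikeElem_val.comul_eq_tmul_self, ← (ℛ k x).eq]
    simp [Finset.sum_mul]
  simp [hitR, h, Finset.sum_mul]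

/-- In Sweedler notation: `h₁ y ψ(h₂) = h₁ y₁ ψ(h₂ y₂ S(y₃))`. -/
lemma hitR_mul_eq_sum {ι : Type*} [Fintype ι] (b : Module.Basis ι k H) (ψ : Module.Dual k H)
    (h y : H) : hitR ψ h * y = ∑ j, hitR (b.coord j)
      (h * hitR (ψ ∘ₗ LinearMap.mulLeft k (b j) ∘ₗ antipode k) y) := by
  have h1 : ∀ x : H, ∑ j, b.coord j ∘ₗ LinearMap.mulLeft k x ∘ₗ
      hitR (ψ ∘ₗ LinearMap.mulLeft k (b j) ∘ₗ antipode k) = ψ x • counit := fun x => by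
    ext y
    have h2 := congrArg (fun z => ψ (x * z)) (sum_mul_antipode_eq_smul (ℛ k y))
    simp only [Finset.mul_sum, map_sum, mul_smul_comm, map_smul, mul_one, smul_eq_mul] at h2
    rw [LinearMap.smul_apply, smul_eq_mul, mul_comm, ← h2]
    simp only [LinearMap.sum_apply, LinearMap.comp_apply, hitR_eq_sum _ (ℛ k y), map_sum,
      map_smul, LinearMap.mulLeft_apply, smul_eq_mul]
    rw [Finset.sum_comm]
    refine Finset.sum_congr rfl fun i _ => ?_
    rw [← mul_assoc, ← sum_coord_mul_apply b]
    exact Finset.sum_congr rfl fun j _ => mul_comm _ _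
  simp only [hitR_mul _ h _ (ℛ k h), hitR_hitR]
  rw [Finset.sum_comm]
  simp only [← Finset.mul_sum, sum_hitR_apply, LinearMap.comp_assoc, h1, hitR_smul, hitR_counit]
  rw [hitR_eq_sum ψ (ℛ k h)]
  simp [Finset.sum_mul]

lemma mem_rightIntegrals {μ : Module.Dual k H} :
    μ ∈ rightIntegrals k H ↔ ∀ x, hitL μ x = μ x • 1 := Iff.rfl

lemma mem_leftIntegrals {μ : Module.Dual k H} :
    μ ∈ leftIntegrals k H ↔ ∀ x, hitR μ x = μ x • 1 := Iff.rfl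

/-- The identity `α(x₁) x₂ S(x₃) = α(x) 1`. -/
lemma sum_hitL_mul_antipode (α : Module.Dual k H) {x : H} {ι : Type*} (r : Repr k x ι) :
    ∑ i ∈ r.index, hitL α (r.left i) * antipode k (r.right i) = α x • 1 := by
  have := congrArg ((TensorProduct.lid k H).toLinearMap ∘ₗ TensorProduct.map α
    (LinearMap.mul' k H ∘ₗ TensorProduct.map LinearMap.id (antipode k)))
    (sum_tmul_tmul_eq r (fun i => ℛ k (r.left i)) (fun i => ℛ k (r.right i)))
  simp only [map_sum, LinearMap.comp_apply, TensorProduct.map_tmul, LinearEquiv.coe_coe,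
    TensorProduct.lid_tmul, LinearMap.mul'_apply, LinearMap.id_apply, ← Finset.smul_sum,
    sum_mul_antipode_eq_smul (ℛ k (r.right _))] at this
  simp only [hitL_eq_sum _ (ℛ k (r.left _)), Finset.sum_mul, smul_mul_assoc, this]
  rw [← counit_hitL α x, hitL_eq_sum α r]
  simp [Finset.sum_smul, mul_smul]

/-- The identity `μ(a₁ b) a₂ = S(b₂) μ(a b₁)`. -/
lemma hitL_comp_mulRight {μ : Module.Dual k H} (hμ : μ ∈ rightIntegrals k H) (a b : H) :
    hitL (μ ∘ₗ LinearMap.mulRight k b) a = antipode k (hitL (μ ∘ₗ LinearMap.mulLeft k a) b) := by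
  have h1 : ∑ i ∈ (ℛ k b).index, hitL μ (a * (ℛ k b).left i) * antipode k ((ℛ k b).right i) =
      antipode k (hitL (μ ∘ₗ LinearMap.mulLeft k a) b) := by
    simp [mem_rightIntegrals.1 hμ, hitL_eq_sum _ (ℛ k b)]
  rw [← h1]
  simp only [hitL_mul μ a _ (ℛ k a), Finset.sum_mul]
  rw [Finset.sum_comm, hitL_eq_sum _ (ℛ k a)]
  refine Finset.sum_congr rfl fun i _ => ?_
  simp only [mul_assoc, ← Finset.mul_sum]
  rw [sum_hitL_mul_antipode]
  simp

end Hits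

/-! ### The inverse antipode -/

section Pivotal

variable {k H : Type u} [Field k] [Ring H] [HopfAlgebra k H] (p : Pivot k H)

lemma Pivot.inv_mul_self : ((p.g⁻¹ : GroupLike k H) : H) * (p.g : H) = 1 := by simp

lemma Pivot.mul_inv_self : (p.g : H) * ((p.g⁻¹ : GroupLike k H) : H) = 1 := by simp

lemma Pivot.inv_mul_cancel_left (x : H) :
    ((p.g⁻¹ : GroupLike k H) : H) * ((p.g : H) * x) = x := by
  rw [← mul_assoc, p.inv_mul_self, one_mul]

lemma Pivot.mul_inv_cancel_left (x : H) :
    (p.g : H) * (((p.g⁻¹ : GroupLike k H) : H) * x) = x := by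
  rw [← mul_assoc, p.mul_inv_self, one_mul]

lemma Pivot.antipode_g : antipode k (p.g : H) = ((p.g⁻¹ : GroupLike k H) : H) := rfl

lemma Pivot.antipode_g_inv : antipode k ((p.g⁻¹ : GroupLike k H) : H) = (p.g : H) := by simp

/-- The inverse of the antipode, `x ↦ g⁻¹ S(x) g`; since `S²` is conjugation by `g`, no appeal to
the bijectivity of antipodes in finite dimension is needed. -/
def Pivot.antipodeInv : H →ₗ[k] H :=
  LinearMap.mulLeft k ((p.g⁻¹ : GroupLike k H) : H) ∘ₗ LinearMap.mulRight k (p.g : H) ∘ₗ antipode k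

lemma Pivot.antipodeInv_apply (x : H) :
    p.antipodeInv x = ((p.g⁻¹ : GroupLike k H) : H) * (antipode k x * (p.g : H)) := rfl

lemma Pivot.antipode_antipodeInv (x : H) : antipode k (p.antipodeInv x) = x := by
  simp only [antipodeInv_apply, antipode_mul_antidistrib, p.antipode_g_inv, p.antipode_g,
    p.antipode_antipode, mul_assoc, p.inv_mul_cancel_left, p.inv_mul_self, mul_one]

lemma Pivot.antipodeInv_antipode (x : H) : p.antipodeInv (antipode k x) = x := by
  simp only [antipodeInv_apply, p.antipode_antipode, mul_assoc, p.inv_mul_cancel_left,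
    p.inv_mul_self, mul_one]

lemma Pivot.antipodeInv_mul (x y : H) :
    p.antipodeInv (x * y) = p.antipodeInv y * p.antipodeInv x := by
  simp only [antipodeInv_apply, antipode_mul_antidistrib, mul_assoc, p.mul_inv_cancel_left]

lemma Pivot.antipodeInv_one : p.antipodeInv (1 : H) = 1 := by
  simp only [antipodeInv_apply, antipode_one, one_mul, p.inv_mul_self]

/-- The square of the inverse antipode is conjugation by the pivot. -/
lemma Pivot.antipodeInv_antipodeInv (x : H) : p.antipodeInv (p.antipodeInv x) =
    ((p.g⁻¹ : GroupLike k H) : H) * (x * (p.g : H)) := by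
  rw [p.antipodeInv_apply, p.antipode_antipodeInv]

/-- The inverse square of the antipode is a coalgebra map. -/
lemma Pivot.hitR_antipodeInv_antipodeInv (α : Module.Dual k H) (x : H) :
    hitR α (p.antipodeInv (p.antipodeInv x)) =
      p.antipodeInv (p.antipodeInv (hitR (α ∘ₗ p.antipodeInv ∘ₗ p.antipodeInv) x)) := by
  simp only [antipodeInv_antipodeInv, hitR_groupLike_mul, hitR_mul_groupLike]
  congr 4
  ext y
  simp [p.antipodeInv_antipodeInv]

lemma Pivot.sum_antipodeInv_mul {x : H} {ι : Type*} (r : Repr k x ι) :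
    ∑ i ∈ r.index, p.antipodeInv (r.right i) * r.left i = counit (R := k) x • 1 := by
  have := congrArg p.antipodeInv (sum_antipode_mul_eq_smul r)
  simpa [p.antipodeInv_mul, p.antipodeInv_antipode, p.antipodeInv_one] using this

lemma Pivot.sum_mul_antipodeInv {x : H} {ι : Type*} (r : Repr k x ι) :
    ∑ i ∈ r.index, r.right i * p.antipodeInv (r.left i) = counit (R := k) x • 1 := by
  have := congrArg p.antipodeInv (sum_mul_antipode_eq_smul r)
  simpa [p.antipodeInv_mul, p.antipodeInv_antipode, p.antipodeInv_one] using this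

/-- The form `h ↦ Tr(y ↦ φ(w₁) w₂)`, where `w = h S⁻²(y)`. -/
def traceIntegral (φ : Module.Dual k H) : Module.Dual k H where
  toFun h := LinearMap.trace k H
    (hitL φ ∘ₗ LinearMap.mulLeft k h ∘ₗ p.antipodeInv ∘ₗ p.antipodeInv)
  map_add' x y := by
    rw [← map_add, ← LinearMap.comp_add, ← LinearMap.add_comp]
    congr 3
    ext; simp [add_mul]
  map_smul' c x := by
    rw [RingHom.id_apply, ← map_smul, ← LinearMap.comp_smul, ← LinearMap.smul_comp]
    congr 3
    ext; simp

lemma traceIntegral_apply (φ : Module.Dual k H) (h : H) : traceIntegral p φ h =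
    LinearMap.trace k H (hitL φ ∘ₗ LinearMap.mulLeft k h ∘ₗ p.antipodeInv ∘ₗ p.antipodeInv) := rfl

end Pivotal

/-! ### Existence, uniqueness and Frobenius property of integrals -/

section Integral

variable {k H : Type u} [Field k] [Ring H] [HopfAlgebra k H] [FiniteDimensional k H]

/-- A right ideal stable under all maps `hitR ψ` that contains a non-zero element contains `1`. -/
lemma one_mem_of_hitR_mem (N : Submodule k H) (hmul : ∀ a ∈ N, ∀ x, a * x ∈ N)
    (hhit : ∀ a ∈ N, ∀ ψ : Module.Dual k H, hitR ψ a ∈ N) (hN : N ≠ ⊥) : (1 : H) ∈ N := by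
  obtain ⟨a, ha, ha0⟩ := N.exists_mem_ne_zero_of_ne_bot hN
  obtain ⟨ψ, hψ⟩ : ∃ ψ : Module.Dual k H, ψ a ≠ 0 := by
    by_contra! h
    exact ha0 ((Module.forall_dual_apply_eq_zero_iff k a).1 h)
  let b := Module.Basis.ofVectorSpace k H
  have hc := hhit a ha ψ
  set c := hitR ψ a with hcdef
  have hεc : counit (R := k) c ≠ 0 := by rwa [hcdef, counit_hitR]
  -- This is `c₁ S(c₂) = ε(c)`, and each summand on the left lies in `N`.
  have h1 : ∑ j, hitR (b.coord j) c * antipode k (b j) = counit (R := k) c • 1 := by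
    rw [← sum_mul_antipode_eq_smul (ℛ k c)]
    simp only [hitR_eq_sum _ (ℛ k c), Finset.sum_mul]
    rw [Finset.sum_comm]
    refine Finset.sum_congr rfl fun i _ => ?_
    conv_rhs => rw [← b.sum_repr ((ℛ k c).right i)]
    simp [Finset.mul_sum, -Module.Basis.sum_repr]
  have h2 : counit (R := k) c • (1 : H) ∈ N := by
    rw [← h1]
    exact N.sum_mem fun j _ => hmul _ (hhit _ hc _) _
  exact (N.smul_mem_iff hεc).1 h2

/-- A non-zero right integral is a Frobenius form. -/
lemma eq_zero_of_rightIntegral {μ : Module.Dual k H} (hμ : μ ∈ rightIntegrals k H) (hμ0 : μ ≠ 0)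
    {a : H} (ha : ∀ x, μ (a * x) = 0) : a = 0 := by
  let N : Submodule k H :=
    { carrier := {a | ∀ x, μ (a * x) = 0}
      zero_mem' := by simp
      add_mem' := fun ha hb x => by rw [add_mul, map_add, ha x, hb x, add_zero]
      smul_mem' := fun c a ha x => by rw [smul_mul_assoc, map_smul, ha x, smul_zero] }
  by_contra h0
  have h1 : (1 : H) ∈ N := by
    refine one_mem_of_hitR_mem N (fun a ha x y => ?_) (fun a ha ψ x => ?_) fun h => h0 ?_
    · rw [mul_assoc]; exact ha _
    · have h2 : μ ∘ₗ LinearMap.mulLeft k a = 0 := LinearMap.ext ha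
      calc μ (hitR ψ a * x) = ψ (hitL (μ ∘ₗ LinearMap.mulRight k x) a) :=
            apply_hitR (μ ∘ₗ LinearMap.mulRight k x) ψ a
        _ = 0 := by rw [hitL_comp_mulRight hμ, h2]; simp [hitL]
    · rwa [← Submodule.mem_bot k, ← h]
  exact hμ0 (LinearMap.ext fun x => by simpa using h1 x)

/-- Every linear form is a translate `μ(a ·)` of a Frobenius form `μ`. -/
lemma exists_eq_comp_mulLeft {μ : Module.Dual k H} (h : ∀ a, (∀ x, μ (a * x) = 0) → a = 0)
    (ν : Module.Dual k H) : ∃ a, ν = μ ∘ₗ LinearMap.mulLeft k a := by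
  let F : H →ₗ[k] Module.Dual k H := LinearMap.mul k H |>.compr₂ μ
  have hF : Function.Injective F := by
    rw [injective_iff_map_eq_zero]
    exact fun a ha => h a fun x => LinearMap.congr_fun ha x
  obtain ⟨a, ha⟩ := (LinearMap.injective_iff_surjective_of_finrank_eq_finrank
    Subspace.dual_finrank_eq.symm).1 hF ν
  exact ⟨a, ha.symm⟩

/-- If `ν = μ(b ·)` is a right integral, then `b₁ ⊗ b₂ = b ⊗ 1`, so `b` is a scalar. -/
lemma exists_eq_smul_of_rightIntegral {μ ν : Module.Dual k H} (hμ : μ ∈ rightIntegrals k H)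
    (hμ0 : μ ≠ 0) (hν : ν ∈ rightIntegrals k H) : ∃ c : k, c • μ = ν := by
  obtain ⟨b, rfl⟩ := exists_eq_comp_mulLeft (fun a => eq_zero_of_rightIntegral hμ hμ0) ν
  have h1 : ∀ ψ : Module.Dual k H, hitR ψ b = ψ 1 • b := fun ψ => by
    refine sub_eq_zero.1 (eq_zero_of_rightIntegral hμ hμ0 fun x => ?_)
    have := apply_hitR (μ ∘ₗ LinearMap.mulRight k x) ψ b
    rw [hitL_comp_mulRight hμ, mem_rightIntegrals.1 hν, map_smul, antipode_one, map_smul] at this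
    simp only [LinearMap.comp_apply, LinearMap.mulRight_apply, LinearMap.mulLeft_apply,
      smul_eq_mul] at this
    rw [sub_mul, map_sub, this, smul_mul_assoc, map_smul, smul_eq_mul, mul_comm, sub_self]
  have h2 : b = counit (R := k) b • 1 := by
    refine sub_eq_zero.1 ((Module.forall_dual_apply_eq_zero_iff k _).1 fun ψ => ?_)
    have := congrArg (counit (R := k)) (h1 ψ)
    rw [counit_hitR, map_smul, smul_eq_mul] at this
    rw [map_sub, this, map_smul, smul_eq_mul, mul_comm, sub_self]
  refine ⟨counit (R := k) b, LinearMap.ext fun x => ?_⟩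
  conv_rhs => rw [h2]
  simp

variable (p : Pivot k H)

/-- Cyclicity of the trace moves the factor `hitR (b.coord j)` of `hitR_mul_eq_sum` to the right,
where it cancels. -/
lemma traceIntegral_mem (φ : Module.Dual k H) : traceIntegral p φ ∈ rightIntegrals k H := by
  let b := Module.Basis.ofVectorSpace k H
  rw [mem_rightIntegrals]
  intro h
  refine sub_eq_zero.1 ((Module.forall_dual_apply_eq_zero_iff k _).1 fun ψ => ?_)
  rw [map_sub, ← apply_hitR, map_smul, sub_eq_zero, traceIntegral_apply, traceIntegral_apply]
  let X := hitL φ ∘ₗ LinearMap.mulLeft k h ∘ₗ p.antipodeInv ∘ₗ p.antipodeInv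
  have h1 : hitL φ ∘ₗ LinearMap.mulLeft k (hitR ψ h) ∘ₗ p.antipodeInv ∘ₗ p.antipodeInv =
      ∑ j, hitR (b.coord j) ∘ₗ X ∘ₗ hitR (ψ ∘ₗ LinearMap.mulLeft k (b j) ∘ₗ p.antipodeInv) := by
    ext y
    simp only [LinearMap.comp_apply, LinearMap.mulLeft_apply, LinearMap.sum_apply,
      hitR_mul_eq_sum b, map_sum, X]
    refine Finset.sum_congr rfl fun j _ => ?_
    have h3 : ψ ∘ₗ LinearMap.mulLeft k (b j) ∘ₗ p.antipodeInv =
        (ψ ∘ₗ LinearMap.mulLeft k (b j) ∘ₗ antipode k) ∘ₗ p.antipodeInv ∘ₗ p.antipodeInv := by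
      ext z
      simp [p.antipode_antipodeInv]
    rw [hitL_hitR, p.hitR_antipodeInv_antipodeInv, h3]
  have h2 : ∑ j, hitR ((ψ ∘ₗ LinearMap.mulLeft k (b j) ∘ₗ p.antipodeInv) ∘ₗ hitR (b.coord j)) =
      ψ 1 • LinearMap.id := by
    ext y
    rw [LinearMap.sum_apply, sum_hitR_apply]
    trans hitR (ψ 1 • (counit : Module.Dual k H)) y
    · congr 2
      ext z
      have h3 := congrArg ψ (p.sum_mul_antipodeInv (ℛ k z))
      simp only [map_sum, map_smul, smul_eq_mul] at h3
      rw [LinearMap.smul_apply, smul_eq_mul, mul_comm, ← h3]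
      simp only [LinearMap.sum_apply, LinearMap.comp_apply, hitR_eq_sum _ (ℛ k z), map_sum,
        map_smul, LinearMap.mulLeft_apply, smul_eq_mul]
      rw [Finset.sum_comm]
      exact Finset.sum_congr rfl fun i _ => sum_coord_mul_apply b _ _ _
    · rw [hitR_smul, hitR_counit]; rfl
  have h4 : ∀ α β : Module.Dual k H, hitR α ∘ₗ hitR β = hitR (α ∘ₗ hitR β) := fun α β =>
    LinearMap.ext (hitR_hitR α β)
  rw [h1, map_sum]
  simp_rw [LinearMap.trace_comp_comm' _ (hitR (b.coord _)), LinearMap.comp_assoc, h4]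
  have h5 : ∀ f : Module.Basis.ofVectorSpaceIndex k H → Module.End k H,
      ∑ j, X ∘ₗ f j = X ∘ₗ ∑ j, f j := fun f => by
    ext; simp [map_sum]
  rw [← map_sum, h5, h2]
  rw [LinearMap.comp_smul, LinearMap.comp_id, map_smul, smul_eq_mul, smul_eq_mul, mul_comm]

/-- The forms `traceIntegral p φ` determine every form, so they do not all vanish. -/
lemma sum_traceIntegral {ι : Type*} [Fintype ι] (b : Module.Basis ι k H) (φ : Module.Dual k H)
    (h : H) :
    ∑ j, traceIntegral p (b.coord j ∘ₗ hitL φ) (h * p.antipodeInv (b j)) = φ h := by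
  -- With `u = φ(v₁) v₂`, `v = h S⁻¹(y)`, the left-hand side maps `y` to `S⁻¹(u₂) u₁ = ε(u)`, so it
  -- has rank one and its trace is `φ(h)`; moving the first factor to the end gives the integrals.
  have h1 : ∑ j, (LinearMap.mulRight k (b j) ∘ₗ p.antipodeInv) ∘ₗ
      hitL (b.coord j) ∘ₗ hitL φ ∘ₗ LinearMap.mulLeft k h ∘ₗ p.antipodeInv =
      (φ ∘ₗ LinearMap.mulLeft k h ∘ₗ p.antipodeInv).smulRight 1 := by
    ext y
    rw [LinearMap.smulRight_apply]
    simp only [LinearMap.comp_apply]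
    rw [← counit_hitL φ, ← p.sum_antipodeInv_mul (ℛ k _)]
    simp only [LinearMap.sum_apply, LinearMap.comp_apply, hitL_eq_sum (b.coord _) (ℛ k _), map_sum,
      map_smul]
    rw [Finset.sum_comm]
    refine Finset.sum_congr rfl fun i _ => ?_
    conv_rhs => rw [← b.sum_repr ((ℛ k _).left i)]
    simp [Finset.mul_sum, -Module.Basis.sum_repr]
  have h2 := congrArg (LinearMap.trace k H) h1
  rw [LinearMap.trace_smulRight, map_sum] at h2
  simp only [LinearMap.comp_apply, p.antipodeInv_one, LinearMap.mulLeft_apply, mul_one] at h2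
  rw [← h2]
  refine Finset.sum_congr rfl fun j _ => ?_
  rw [LinearMap.trace_comp_comm', traceIntegral_apply]
  congr 1
  ext y
  simp [hitL_hitL, p.antipodeInv_mul]

lemma exists_rightIntegral_ne_zero (p : Pivot k H) : ∃ μ ∈ rightIntegrals k H, μ ≠ 0 := by
  by_contra! hall
  have := sum_traceIntegral p (Module.Basis.ofVectorSpace k H) counit 1
  simp only [hall _ (traceIntegral_mem p _), LinearMap.zero_apply, Finset.sum_const_zero,
    Bialgebra.counit_one] at this
  exact zero_ne_one this

lemma finrank_rightIntegrals (p : Pivot k H) : Module.finrank k (rightIntegrals k H) = 1 := by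
  obtain ⟨μ, hμ, hμ0⟩ := exists_rightIntegral_ne_zero p
  refine finrank_eq_one (⟨μ, hμ⟩ : rightIntegrals k H) (by simpa [Subtype.ext_iff] using hμ0)
    fun ν => ?_
  obtain ⟨c, hc⟩ := exists_eq_smul_of_rightIntegral hμ hμ0 ν.2
  exact ⟨c, Subtype.ext hc⟩

/-- The Nakayama automorphism of the integral of a unimodular Hopf algebra is `S²`. If `c` is the
cointegral with `μ(c) = 1`, then `c₁ ⊗ S(c₂)` is a pair of dual bases for `μ`, and
`S²(y) = μ(c₁ y) S(c₂)`. -/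
lemma rightIntegral_mul (hH : IsUnimodular k H) {μ : Module.Dual k H}
    (hμ : μ ∈ rightIntegrals k H) (x y : H) :
    μ (x * y) = μ (antipode k (antipode k y) * x) := by
  rcases eq_or_ne μ 0 with rfl | hμ0
  · simp
  have hnd : ∀ a, (∀ x, μ (a * x) = 0) → a = 0 := fun a => eq_zero_of_rightIntegral hμ hμ0
  -- `c` is a right cointegral because `μ(c z w) = ε(z) ε(w)`.
  obtain ⟨c, hc⟩ := exists_eq_comp_mulLeft hnd counit
  have hcr : IsRightCointegral k c := fun z => by
    refine sub_eq_zero.1 (hnd _ fun w => ?_)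
    have h1 := LinearMap.congr_fun hc (z * w)
    have h2 := LinearMap.congr_fun hc w
    simp only [LinearMap.comp_apply, LinearMap.mulLeft_apply, Bialgebra.counit_mul] at h1 h2
    rw [sub_mul, mul_assoc, map_sub, ← h1, smul_mul_assoc, map_smul, ← h2, smul_eq_mul, sub_self]
  have hμc : μ c = 1 := by simpa using (LinearMap.congr_fun hc 1).symm
  -- Unimodularity enters here: `c` is also a left cointegral.
  have hcl : μ ∘ₗ LinearMap.mulRight k c = counit := LinearMap.ext fun z => by
    simp [hH c hcr z, hμc]
  -- `μ(a c₁) S(c₂) = a`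
  have h1 : ∀ a, antipode k (hitL (μ ∘ₗ LinearMap.mulLeft k a) c) = a := fun a => by
    rw [← hitL_comp_mulRight hμ, hcl, hitL_counit]
  -- `μ(c₁ b) c₂ = S(b)`
  have h2 : ∀ b, hitL (μ ∘ₗ LinearMap.mulRight k b) c = antipode k b := fun b => by
    rw [hitL_comp_mulRight hμ, ← hc, hitL_counit]
  -- `c₁ μ(S(c₂) x) = x`
  have h3 : hitR (μ ∘ₗ LinearMap.mulRight k x ∘ₗ antipode k) c = x := by
    have hnd' : ∀ a, (∀ z, μ (z * a) = 0) → a = 0 := fun a ha => by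
      refine (Module.forall_dual_apply_eq_zero_iff k a).1 fun ψ => ?_
      obtain ⟨z, rfl⟩ := exists_eq_comp_mulLeft hnd ψ
      exact ha z
    refine sub_eq_zero.1 (hnd' _ fun z => ?_)
    have := apply_hitR (μ ∘ₗ LinearMap.mulLeft k z)
      (μ ∘ₗ LinearMap.mulRight k x ∘ₗ antipode k) c
    simp only [LinearMap.comp_apply, h1, LinearMap.mulLeft_apply, LinearMap.mulRight_apply] at this
    rw [mul_sub, map_sub, this, sub_self]
  calc μ (x * y) = (μ ∘ₗ LinearMap.mulRight k y)
          (hitR (μ ∘ₗ LinearMap.mulRight k x ∘ₗ antipode k) c) := by rw [h3]; rfl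
    _ = _ := by rw [apply_hitR, h2]; rfl

end Integral

/-! ### Symmetrised integrals -/

section Symmetrised

variable {k H : Type u} [Field k] [Ring H] [HopfAlgebra k H]

/-- `Δ(S(x)) = S(x₂) ⊗ S(x₁)`. The right-hand side is a left inverse of `Δ` for the convolution
product on `Hom(H, H ⊗ H)`, and `Δ ∘ S` is a right inverse. -/
lemma comul_antipode (x : H) {ι : Type*} (r : Repr k x ι) : comul (R := k) (antipode k x) =
    ∑ i ∈ r.index, antipode k (r.right i) ⊗ₜ[k] antipode k (r.left i) := by
  -- The right-hand side is the convolution product `P * Q`.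
  let P : H →ₗ[k] H ⊗[k] H := TensorProduct.mk k H H 1 ∘ₗ antipode k
  let Q : H →ₗ[k] H ⊗[k] H := (TensorProduct.mk k H H).flip 1 ∘ₗ antipode k
  let I : H →ₗ[k] H ⊗[k] H := TensorProduct.mk k H H 1
  have h1 : WithConv.toConv Q * WithConv.toConv comul = WithConv.toConv I := by
    ext x
    rw [(ℛ k x).convMul_apply]
    have := congrArg (TensorProduct.map (LinearMap.mul' k H ∘ₗ
      TensorProduct.map (antipode k) LinearMap.id) LinearMap.id ∘ₗ
      (TensorProduct.assoc k H H H).symm.toLinearMap) (sum_tmul_tmul_eq (ℛ k x)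
        (fun i => ℛ k ((ℛ k x).left i)) (fun i => ℛ k ((ℛ k x).right i)))
    simp only [map_sum, LinearMap.comp_apply, LinearEquiv.coe_coe, TensorProduct.assoc_symm_tmul,
      TensorProduct.map_tmul, LinearMap.id_apply, LinearMap.mul'_apply,
      ← TensorProduct.sum_tmul, sum_antipode_mul_eq_smul (ℛ k ((ℛ k x).left _)),
      TensorProduct.smul_tmul, ← TensorProduct.tmul_sum, sum_counit_smul] at this
    refine Eq.trans (Finset.sum_congr rfl fun i _ => ?_) this.symm
    rw [WithConv.ofConv_toConv, WithConv.ofConv_toConv]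
    conv_lhs => rw [← (ℛ k ((ℛ k x).right i)).eq]
    simp [Q, Finset.mul_sum, TensorProduct.tmul_sum]
  have h2 : WithConv.toConv P * WithConv.toConv I = 1 := by
    ext x
    rw [(ℛ k x).convMul_apply]
    have := congrArg (TensorProduct.mk k H H 1) (sum_antipode_mul_eq_smul (ℛ k x))
    simp only [map_sum, map_smul] at this
    simpa [P, I, Algebra.algebraMap_eq_smul_one, Algebra.TensorProduct.one_def] using this
  have h3 : WithConv.toConv P * WithConv.toConv Q =
      WithConv.toConv (comul ∘ₗ antipode k : H →ₗ[k] H ⊗[k] H) :=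
    left_inv_eq_right_inv (by rw [mul_assoc, h1, h2]) LinearMap.comul_right_inv
  have h4 := congrArg (fun F => F.ofConv x) h3
  simp only [r.convMul_apply] at h4
  simpa [P, Q] using h4.symm

/-- In Sweedler notation: `φ(S(x)₁) S(x)₂ = S(x₁ φ(S(x₂)))`. -/
lemma hitL_antipode (φ : Module.Dual k H) (x : H) :
    hitL φ (antipode k x) = antipode k (hitR (φ ∘ₗ antipode k) x) := by
  simp [hitL, comul_antipode x (ℛ k x), hitR_eq_sum _ (ℛ k x)]

variable (p : Pivot k H)

/-- Symmetrised right integrals are characterised by `φ(x₁) x₂ = φ(x) g⁻¹`. -/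
lemma mem_symRightIntegrals {φ : Module.Dual k H} : φ ∈ symRightIntegrals p ↔
    ∀ x, hitL φ x = φ x • ((p.g⁻¹ : GroupLike k H) : H) := by
  constructor
  · rintro ⟨μ, hμ, rfl⟩ x
    have h := congrArg (((p.g⁻¹ : GroupLike k H) : H) * ·)
      (hitL_groupLike_mul μ p.g x).symm
    simp only [p.inv_mul_cancel_left, mem_rightIntegrals.1 hμ, mul_smul_comm, mul_one] at h
    exact h
  · intro h
    refine ⟨φ ∘ₗ LinearMap.mulLeft k ((p.g⁻¹ : GroupLike k H) : H),
      mem_rightIntegrals.2 fun x => ?_, LinearMap.ext fun x => ?_⟩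
    · have h1 := congrArg ((p.g : H) * ·) (hitL_groupLike_mul φ p.g⁻¹ x)
      simp only [h, p.mul_inv_cancel_left, mul_smul_comm, p.mul_inv_self] at h1
      exact h1.symm
    · exact congrArg φ (p.inv_mul_cancel_left x)

/-- Symmetrised left integrals are characterised by `x₁ φ(x₂) = φ(x) g`. -/
lemma mem_symLeftIntegrals {φ : Module.Dual k H} : φ ∈ symLeftIntegrals p ↔
    ∀ x, hitR φ x = φ x • (p.g : H) := by
  constructor
  · rintro ⟨μ, hμ, rfl⟩ x
    have h := congrArg ((p.g : H) * ·) (hitR_groupLike_mul μ p.g⁻¹ x).symm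
    simp only [p.mul_inv_cancel_left, mem_leftIntegrals.1 hμ, mul_smul_comm, mul_one] at h
    exact h
  · intro h
    refine ⟨φ ∘ₗ LinearMap.mulLeft k (p.g : H),
      mem_leftIntegrals.2 fun x => ?_, LinearMap.ext fun x => ?_⟩
    · have h1 := congrArg (((p.g⁻¹ : GroupLike k H) : H) * ·) (hitR_groupLike_mul φ p.g x)
      simp only [h, p.inv_mul_cancel_left, mul_smul_comm, p.inv_mul_self] at h1
      exact h1.symm
    · exact congrArg φ (p.mul_inv_cancel_left x)

lemma comp_antipode_mem_symLeftIntegrals {φ : Module.Dual k H} :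
    φ ∘ₗ antipode k ∈ symLeftIntegrals p ↔ φ ∈ symRightIntegrals p := by
  rw [mem_symLeftIntegrals, mem_symRightIntegrals]
  constructor
  · intro h x
    obtain ⟨y, rfl⟩ : ∃ y, antipode k y = x := ⟨_, p.antipode_antipodeInv x⟩
    rw [hitL_antipode, h, map_smul, p.antipode_g]; rfl
  · intro h x
    rw [← p.antipodeInv_antipode (hitR _ x), ← hitL_antipode, h, map_smul, ← p.antipode_g,
      p.antipodeInv_antipode]; rfl

/-- The antipode exchanges symmetrised right and left integrals. -/
lemma map_symRightIntegrals :
    (symRightIntegrals p).map (antipode k).dualMap = symLeftIntegrals p := by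
  ext φ
  constructor
  · rintro ⟨ψ, hψ, rfl⟩
    exact (comp_antipode_mem_symLeftIntegrals p).2 hψ
  · intro h
    have h1 : (φ ∘ₗ p.antipodeInv) ∘ₗ antipode k = φ :=
      LinearMap.ext fun x => congrArg φ (p.antipodeInv_antipode x)
    exact ⟨_, (comp_antipode_mem_symLeftIntegrals p).1 (by rwa [h1]), h1⟩

variable [FiniteDimensional k H]

lemma finrank_symRightIntegrals : Module.finrank k (symRightIntegrals p) = 1 := by
  rw [← finrank_rightIntegrals p]
  refine ((rightIntegrals k H).equivMapOfInjective _
    (LinearMap.dualMap_injective_of_surjective fun x => ?_)).finrank_eq.symm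
  exact ⟨_, p.mul_inv_cancel_left x⟩

lemma finrank_symLeftIntegrals : Module.finrank k (symLeftIntegrals p) = 1 := by
  rw [← finrank_symRightIntegrals p, ← map_symRightIntegrals]
  refine ((symRightIntegrals p).equivMapOfInjective _
    (LinearMap.dualMap_injective_of_surjective fun x => ?_)).finrank_eq.symm
  exact ⟨_, p.antipode_antipodeInv x⟩

/-- The twist by `g` turns the Nakayama automorphism `S²` into the identity. -/
lemma symRightIntegral_mul_comm (hH : IsUnimodular k H) {φ : Module.Dual k H}
    (hφ : φ ∈ symRightIntegrals p) (x y : H) : φ (x * y) = φ (y * x) := by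
  obtain ⟨μ, hμ, rfl⟩ := hφ
  have h := rightIntegral_mul hH hμ ((p.g : H) * x) y
  rw [p.antipode_antipode] at h
  simp only [mul_assoc, p.inv_mul_cancel_left] at h
  exact h

lemma eq_zero_of_symRightIntegral {φ : Module.Dual k H} (hφ : φ ∈ symRightIntegrals p)
    (hφ0 : φ ≠ 0) {a : H} (ha : ∀ x, φ (a * x) = 0) : a = 0 := by
  obtain ⟨μ, hμ, rfl⟩ := hφ
  have h0 : μ ≠ 0 := by rintro rfl; exact hφ0 (map_zero _)
  have := eq_zero_of_rightIntegral hμ h0 (a := (p.g : H) * a) fun x => by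
    rw [mul_assoc]; exact ha x
  rw [← p.inv_mul_cancel_left a, this, mul_zero]

lemma symLeftIntegral_mul_comm (hH : IsUnimodular k H) {φ : Module.Dual k H}
    (hφ : φ ∈ symLeftIntegrals p) (x y : H) : φ (x * y) = φ (y * x) := by
  rw [← map_symRightIntegrals] at hφ
  obtain ⟨ψ, hψ, rfl⟩ := hφ
  simp only [LinearMap.dualMap_apply, antipode_mul_antidistrib]
  exact symRightIntegral_mul_comm p hH hψ _ _

lemma eq_zero_of_symLeftIntegral (hH : IsUnimodular k H) {φ : Module.Dual k H}
    (hφ : φ ∈ symLeftIntegrals p) (hφ0 : φ ≠ 0) {a : H} (ha : ∀ x, φ (a * x) = 0) : a = 0 := by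
  have hφ' := hφ
  rw [← map_symRightIntegrals] at hφ
  obtain ⟨ψ, hψ, rfl⟩ := hφ
  have h0 : ψ ≠ 0 := by rintro rfl; exact hφ0 (map_zero _)
  have := eq_zero_of_symRightIntegral p hψ h0 (a := antipode k a) fun x => by
    have h := ha (p.antipodeInv x)
    rw [symLeftIntegral_mul_comm p hH hφ', LinearMap.dualMap_apply, antipode_mul_antidistrib,
      p.antipode_antipodeInv] at h
    exact h
  rw [← p.antipodeInv_antipode a, this, map_zero]

end Symmetrised

/-! ### Cyclic families of traces and symmetric forms -/

section Cyclic

variable {k H : Type u} [Field k] [Ring H] [HopfAlgebra k H]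

/-- A decomposition of `id_P` splits every composite through `P`. -/
lemma eq_sum_comp {P Q R : FDMod k H} {ι : Type*} [Fintype ι] {M : ι → FDMod k H}
    {a : ∀ i, M i →ₗ[H] P} {b : ∀ i, P →ₗ[H] M i} (hab : ∑ i, a i ∘ₗ b i = LinearMap.id)
    (g : P →ₗ[H] R) (f : Q →ₗ[H] P) : g ∘ₗ f = ∑ i, (g ∘ₗ a i) ∘ₗ (b i ∘ₗ f) :=
  LinearMap.ext fun x => by
    have := congrArg g (LinearMap.congr_fun hab (f x))
    rw [LinearMap.sum_apply, map_sum] at this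
    rw [LinearMap.sum_apply]
    exact this.symm

variable [FiniteDimensional k H]

/-- The unit element of the left regular module. -/
def regOne (k H : Type u) [Field k] [Ring H] [HopfAlgebra k H] [FiniteDimensional k H] :
    FDMod.regular k H := (1 : H)

/-- The morphism `H → M`, `h ↦ h m`. -/
def spanHom {M : FDMod k H} (m : M) : FDMod.regular k H →ₗ[H] M :=
  (LinearMap.toSpanSingleton H M m : H →ₗ[H] M)

/-- An element of the left regular module as an element of `H`. The identification is the identity;
it keeps the two types apart, because `FDMod.regular` is not reducible. -/
def regVal : FDMod.regular k H ≃ₗ[H] H := LinearEquiv.refl H H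

/-- A linear form on `H` as a linear form on the left regular module. -/
def regForm (φ : Module.Dual k H) : FDMod.regular k H →ₗ[k] k := φ

lemma regForm_apply (φ : Module.Dual k H) (x : FDMod.regular k H) :
    regForm φ x = φ (regVal x) := rfl

lemma regVal_regOne : regVal (regOne k H) = (1 : H) := rfl

lemma regVal_smul_regOne (x : FDMod.regular k H) : (regVal x) • regOne k H = x :=
  regVal.injective (by rw [map_smul, regVal_regOne, smul_eq_mul, mul_one])

lemma spanHom_apply {M : FDMod k H} (m : M) (x : FDMod.regular k H) :
    spanHom m x = regVal x • m := rfl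

@[simp] lemma spanHom_regOne {M : FDMod k H} (m : M) : spanHom m (regOne k H) = m := one_smul H m

lemma apply_regular {M : FDMod k H} (f : FDMod.regular k H →ₗ[H] M) (x : FDMod.regular k H) :
    f x = regVal x • f (regOne k H) := by
  rw [← map_smul, regVal_smul_regOne]

lemma spanHom_apply_regOne {M : FDMod k H} (f : FDMod.regular k H →ₗ[H] M) :
    spanHom (f (regOne k H)) = f :=
  LinearMap.ext fun x => (apply_regular f x).symm

lemma regForm_comp_comm (φ : Module.Dual k H)
    (hφ : ∀ x y, φ (x * y) = φ (y * x)) (v w : FDMod.regular k H →ₗ[H] FDMod.regular k H) :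
    regForm φ (v (w (regOne k H))) = regForm φ (w (v (regOne k H))) := by
  rw [apply_regular v, apply_regular w (v _), regForm_apply, regForm_apply, map_smul regVal,
    map_smul regVal, smul_eq_mul, smul_eq_mul, hφ]

/-- The linear form `t_H` on the endomorphisms of the left regular module. -/
def regTrace (t : TraceFamily k H) :
    (FDMod.regular k H →ₗ[H] FDMod.regular k H) →ₗ[k] k := t (regularProj k H)

/-- The linear form `λ` on `H` with `t_H(f) = λ(f(1))`. -/
def traceForm (t : TraceFamily k H) : Module.Dual k H where
  toFun h := regTrace t (spanHom (regVal.symm h))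
  map_add' x y := by
    rw [← map_add]
    exact congrArg _ (LinearMap.ext fun z => smul_add _ _ _)
  map_smul' c x := by
    rw [RingHom.id_apply, ← map_smul]
    exact congrArg _ (LinearMap.ext fun z => mul_smul_comm c (regVal z) x)

lemma regTrace_apply (t : TraceFamily k H) (f : FDMod.regular k H →ₗ[H] FDMod.regular k H) :
    regTrace t f = regForm (traceForm t) (f (regOne k H)) :=
  congrArg (regTrace t) (spanHom_apply_regOne f).symm

/-- The value on an endomorphism that factors through the regular module. -/
lemma IsCyclic.apply_comp {t : TraceFamily k H} (ht : IsCyclic t) (P : ProjMod k H)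
    (u : FDMod.regular k H →ₗ[H] P.1) (v : P.1 →ₗ[H] FDMod.regular k H) :
    t P (u ∘ₗ v) = regForm (traceForm t) (v (u (regOne k H))) :=
  (ht P (regularProj k H) v u).trans (regTrace_apply t (v ∘ₗ u))

/-- A finitely generated projective module is a retract of a free module of finite rank. -/
lemma exists_frame (P : ProjMod k H) : ∃ (n : ℕ) (a : Fin n → (FDMod.regular k H →ₗ[H] P.1))
    (b : Fin n → (P.1 →ₗ[H] FDMod.regular k H)), ∑ i, a i ∘ₗ b i = LinearMap.id := by
  have := P.2
  have : Module.Finite H P.1 := Module.Finite.of_restrictScalars_finite k H P.1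
  obtain ⟨n, e, he⟩ := Module.Finite.exists_fin' H P.1
  obtain ⟨s, hs⟩ := Module.projective_lifting_property e LinearMap.id he
  refine ⟨n, fun i => (e ∘ₗ LinearMap.single H (fun _ => H) i : H →ₗ[H] P.1),
    fun i => (LinearMap.proj i ∘ₗ s : P.1 →ₗ[H] H), LinearMap.ext fun x => ?_⟩
  rw [LinearMap.sum_apply]
  refine Eq.trans ?_ (LinearMap.congr_fun hs x)
  trans e (∑ i, Pi.single i (s x i))
  · rw [map_sum]; rfl
  · rw [Finset.univ_sum_single]; rfl

lemma IsCyclic.apply_eq_sum {t : TraceFamily k H} (ht : IsCyclic t) (P : ProjMod k H)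
    {ι : Type*} [Fintype ι] {a : ι → (FDMod.regular k H →ₗ[H] P.1)}
    {b : ι → (P.1 →ₗ[H] FDMod.regular k H)}
    (hab : ∑ i, a i ∘ₗ b i = LinearMap.id) (f : P.1 →ₗ[H] P.1) :
    t P f = ∑ i, regForm (traceForm t) (b i (f (a i (regOne k H)))) := by
  have h := eq_sum_comp hab f LinearMap.id
  rw [LinearMap.comp_id] at h
  conv_lhs => rw [h]
  rw [map_sum]
  exact Finset.sum_congr rfl fun i _ => ht.apply_comp P (f ∘ₗ a i) (b i)

/-- A cyclic family is determined by its value on the regular module. -/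
lemma IsCyclic.eq_of_traceForm_eq {s t : TraceFamily k H} (hs : IsCyclic s) (ht : IsCyclic t)
    (h : traceForm s = traceForm t) : s = t := by
  funext P
  ext f
  obtain ⟨n, a, b, hab⟩ := exists_frame P
  rw [hs.apply_eq_sum P hab, ht.apply_eq_sum P hab, h]

/-- The family `t_P(f) = ∑ᵢ φ(bᵢ(f(aᵢ(1))))`, where `∑ᵢ aᵢ bᵢ = id_P` factors through copies
of `H`. -/
def symTrace (φ : Module.Dual k H) : TraceFamily k H := fun P =>
  { toFun := fun f => ∑ i, regForm φ ((exists_frame P).choose_spec.choose_spec.choose i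
      (f ((exists_frame P).choose_spec.choose i (regOne k H))))
    map_add' := fun f g => by
      simp only [LinearMap.add_apply, map_add, Finset.sum_add_distrib]
    map_smul' := fun c f => by
      simp only [LinearMap.smul_apply, LinearMap.map_smul_of_tower, RingHom.id_apply,
        Finset.smul_sum] }

/-- On endomorphisms that factor through `H`, the family `symTrace φ` does not depend on the chosen
decomposition of `id_P`. -/
lemma symTrace_comp {φ : Module.Dual k H} (hφ : ∀ x y, φ (x * y) = φ (y * x)) (P : ProjMod k H)
    (u : FDMod.regular k H →ₗ[H] P.1) (v : P.1 →ₗ[H] FDMod.regular k H) :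
    symTrace φ P (u ∘ₗ v) = regForm φ (v (u (regOne k H))) := by
  have hab := (exists_frame P).choose_spec.choose_spec.choose_spec
  let a := (exists_frame P).choose_spec.choose
  let b := (exists_frame P).choose_spec.choose_spec.choose
  have h := congrArg v (LinearMap.congr_fun hab (u (regOne k H)))
  rw [LinearMap.sum_apply, map_sum] at h
  refine Eq.trans ?_ (congrArg (regForm φ) h)
  rw [map_sum]
  change ∑ i, regForm φ (b i (u (v (a i (regOne k H))))) =
    ∑ i, regForm φ (v (a i (b i (u (regOne k H)))))
  exact Finset.sum_congr rfl fun i _ => regForm_comp_comm φ hφ (b i ∘ₗ u) (v ∘ₗ a i)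

lemma isCyclic_symTrace {φ : Module.Dual k H} (hφ : ∀ x y, φ (x * y) = φ (y * x)) :
    IsCyclic (symTrace φ) := by
  intro P P' f g
  have hab := (exists_frame P').choose_spec.choose_spec.choose_spec
  rw [eq_sum_comp hab g f, map_sum]
  exact Finset.sum_congr rfl fun i _ => symTrace_comp hφ P (g ∘ₗ _) (_ ∘ₗ f)

lemma traceForm_symTrace {φ : Module.Dual k H} (hφ : ∀ x y, φ (x * y) = φ (y * x)) :
    traceForm (symTrace φ) = φ :=
  LinearMap.ext fun h => (symTrace_comp hφ (regularProj k H)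
    (spanHom (regVal.symm h)) LinearMap.id).trans
      (congrArg (regForm φ) (spanHom_regOne _))

/-- A cyclic family whose form on `H` is a symmetric Frobenius form is non-degenerate: composition
with the form identifies `Hom_H(M, H)` with `M^*`. -/
lemma IsCyclic.isNondegenerate {t : TraceFamily k H} (ht : IsCyclic t)
    (hsym : ∀ x y, traceForm t (x * y) = traceForm t (y * x))
    (hnd : ∀ a, (∀ x, traceForm t (a * x) = 0) → a = 0) : IsNondegenerate t := by
  intro P M
  obtain ⟨n, a, b, hab⟩ := exists_frame P
  refine ⟨fun f hf => ?_, fun f hf => ?_⟩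
  · have h1 : ∀ i, b i ∘ₗ f = 0 := fun i => LinearMap.ext fun m => by
      refine regVal.injective ((hnd _ fun x => ?_).trans (map_zero _).symm)
      have h2 := hf (spanHom (x • m) ∘ₗ b i)
      rw [← LinearMap.comp_assoc, ht.apply_comp] at h2
      rw [hsym, ← smul_eq_mul, ← map_smul, ← map_smul, ← regForm_apply]
      refine Eq.trans ?_ h2
      exact congrArg (fun y => regForm (traceForm t) (b i (f y))) (spanHom_regOne _).symm
    ext m
    rw [← LinearMap.id_apply (R := H) (f m), ← hab, LinearMap.sum_apply]
    exact Finset.sum_eq_zero fun i _ => (congrArg (a i) (LinearMap.congr_fun (h1 i) m)).trans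
      (map_zero _)
  · have h1 : ∀ i, f ∘ₗ a i = 0 := fun i => by
      have h0 : f (a i (regOne k H)) = 0 := by
        refine (Module.forall_dual_apply_eq_zero_iff k _).1 fun ψ => ?_
        -- The morphism `G : M → H` whose composite with the form is `ψ`.
        choose F hF using fun m : M => exists_eq_comp_mulLeft hnd
          (ψ ∘ₗ ((LinearMap.toSpanSingleton H M m).restrictScalars k))
        have hF' : ∀ m x, traceForm t (F m * x) = ψ (x • m) := fun m x =>
          (LinearMap.congr_fun (hF m) x).symm
        let G : M →ₗ[H] FDMod.regular k H := regVal.symm.toLinearMap ∘ₗ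
          { toFun := F
            map_add' := fun m m' => sub_eq_zero.1 (hnd _ fun x => by
              rw [sub_mul, add_mul, map_sub, map_add, hF', hF', hF', smul_add, map_add, sub_self])
            map_smul' := fun h m => sub_eq_zero.1 (hnd _ fun x => by
              rw [RingHom.id_apply, smul_eq_mul, sub_mul, map_sub, hF', mul_assoc, hsym, mul_assoc,
                hF', mul_smul, sub_self]) }
        have h2 := hf (a i ∘ₗ G)
        rw [LinearMap.comp_assoc, ht.apply_comp] at h2
        have h3 := hF' (f (a i (regOne k H))) 1
        rw [one_smul, mul_one] at h3
        exact h3.symm.trans h2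
      refine LinearMap.ext fun x => ?_
      rw [LinearMap.comp_apply, apply_regular (a i), map_smul, h0, smul_zero]; rfl
    ext x
    have h2 := congrArg f (LinearMap.congr_fun hab x)
    rw [LinearMap.sum_apply, map_sum] at h2
    exact h2.symm.trans (Finset.sum_eq_zero fun i _ => LinearMap.congr_fun (h1 i) (b i x))

end Cyclic

/-! ### Explicit partial traces -/

section Slots

variable {k H : Type u} [Field k] [Ring H] [HopfAlgebra k H]

/-- The map `id ⊗ φ : W ⊗ V → W`. -/
def slotR (W : FDMod k H) {V : FDMod k H} (φ : Module.Dual k V) : tensor W V →ₗ[k] W :=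
  (TensorProduct.rid k W).toLinearMap ∘ₗ TensorProduct.map LinearMap.id φ ∘ₗ
    (tensorEquiv W V).symm.toLinearMap

@[simp] lemma slotR_tmul (W : FDMod k H) {V : FDMod k H} (φ : Module.Dual k V) (w : W) (v : V) :
    slotR W φ (tensorEquiv W V (w ⊗ₜ v)) = φ v • w := by
  simp [slotR]

/-- The map `φ ⊗ id : V ⊗ W → W`. -/
def slotL (W : FDMod k H) {V : FDMod k H} (φ : Module.Dual k V) : tensor V W →ₗ[k] W :=
  (TensorProduct.lid k W).toLinearMap ∘ₗ TensorProduct.map φ LinearMap.id ∘ₗ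
    (tensorEquiv V W).symm.toLinearMap

@[simp] lemma slotL_tmul (W : FDMod k H) {V : FDMod k H} (φ : Module.Dual k V) (w : W) (v : V) :
    slotL W φ (tensorEquiv V W (v ⊗ₜ w)) = φ v • w := by
  simp [slotL]

lemma tensor_induction {V W : FDMod k H} {C : tensor V W → Prop} (h0 : C 0)
    (hadd : ∀ x y, C x → C y → C (x + y)) (ht : ∀ v w, C (tensorEquiv V W (v ⊗ₜ w)))
    (y : tensor V W) : C y := by
  obtain ⟨x, rfl⟩ := (tensorEquiv V W).surjective y
  induction x using TensorProduct.induction_on with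
  | zero => simpa using h0
  | tmul v w => exact ht v w
  | add x y hx hy => rw [map_add]; exact hadd _ _ hx hy

lemma slotR_tensorHom {W W' V : FDMod k H} (φ : Module.Dual k V) (b : W →ₗ[H] W')
    (y : tensor W V) : slotR W' φ (tensorHom b LinearMap.id y) = b (slotR W φ y) := by
  induction y using tensor_induction with
  | h0 => simp
  | hadd x y hx hy => simp only [map_add, hx, hy]
  | ht w v => simp [LinearMap.map_smul_of_tower]

lemma slotL_tensorHom {W W' V : FDMod k H} (φ : Module.Dual k V) (b : W →ₗ[H] W')
    (y : tensor V W) : slotL W' φ (tensorHom LinearMap.id b y) = b (slotL W φ y) := by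
  induction y using tensor_induction with
  | h0 => simp
  | hadd x y hx hy => simp only [map_add, hx, hy]
  | ht w v => simp [LinearMap.map_smul_of_tower]

variable (p : Pivot k H)

lemma rightPartialTrace_apply (W V : FDMod k H) (f : tensor W V →ₗ[H] tensor W V) (w : W)
    {ι : Type*} [Fintype ι] (b : Module.Basis ι k V) :
    rightPartialTrace p W V f w =
      ∑ i, slotR W (b.coord i ∘ₗ V.act (p.g : H)) (f (tensorEquiv W V (w ⊗ₜ b i))) := by
  have h : ∀ (φ : Module.Dual k V) (y : tensor W V), rightUnitor W
      (tensorHom (LinearMap.id : W →ₗ[H] W) (evTilde p V) (assoc W V (dual V)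
        (tensorEquiv _ _ (y ⊗ₜ dualEquiv V φ)))) = slotR W (φ ∘ₗ V.act (p.g : H)) y := by
    intro φ y
    induction y using tensor_induction with
    | h0 => simp
    | hadd x y hx hy => simp only [map_add, TensorProduct.add_tmul, hx, hy]
    | ht w v => simp
  simp [rightPartialTrace, coev_apply V b, TensorProduct.tmul_sum, h]

lemma leftPartialTrace_apply (W V : FDMod k H) (f : tensor V W →ₗ[H] tensor V W) (w : W)
    {ι : Type*} [Fintype ι] (b : Module.Basis ι k V) :
    leftPartialTrace p V W f w = ∑ i, slotL W (b.coord i)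
      (f (tensorEquiv V W ((((p.g⁻¹ : GroupLike k H) : H) • b i) ⊗ₜ w))) := by
  have h : ∀ (φ : Module.Dual k V) (y : tensor V W), leftUnitor W
      (tensorHom (ev V) (LinearMap.id : W →ₗ[H] W) ((assoc (dual V) V W).symm
        (tensorEquiv _ _ (dualEquiv V φ ⊗ₜ y)))) = slotL W φ y := by
    intro φ y
    induction y using tensor_induction with
    | h0 => simp
    | hadd x y hx hy => simp only [map_add, TensorProduct.tmul_add, hx, hy]
    | ht w v => simp
  simp [leftPartialTrace, coevTilde_apply p V b, TensorProduct.sum_tmul, h]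

end Slots

/-! ### Tensor products with the regular module -/

section Mates

variable {k H : Type u} [Field k] [Ring H] [HopfAlgebra k H] [FiniteDimensional k H]

/-- The morphism `H ⊗ V → H`, `x ⊗ v ↦ x₁ φ(S(x₂) v)`, obtained by duality from the morphism
`H → H ⊗ V^*` with `1 ↦ 1 ⊗ φ`. -/
def mateR {V : FDMod k H} (φ : Module.Dual k V) :
    tensor (regular k H) V →ₗ[H] regular k H :=
  (rightUnitor (regular k H)).toLinearMap ∘ₗ tensorHom LinearMap.id (ev V) ∘ₗ
    (assoc (regular k H) (dual V) V).toLinearMap ∘ₗ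
    tensorHom (spanHom (tensorEquiv _ _ (regOne k H ⊗ₜ dualEquiv V φ))) LinearMap.id

lemma mateR_tmul {V : FDMod k H} (φ : Module.Dual k V) (x : regular k H) (v : V) {ι : Type*}
    (r : Repr k (regVal x) ι) : mateR φ (tensorEquiv _ V (x ⊗ₜ v)) =
      ∑ i ∈ r.index, φ (antipode k (r.right i) • v) • (r.left i • regOne k H) := by
  simp only [mateR, LinearMap.comp_apply, tensorHom_tmul, spanHom_apply,
    smul_tensorEquiv_tmul _ _ _ _ _ r, smul_dualEquiv, map_sum, TensorProduct.sum_tmul,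
    LinearEquiv.coe_coe, LinearMap.id_apply, assoc_tmul, ev_tmul, rightUnitor_tmul]
  rfl

lemma mateR_regOne {V : FDMod k H} (φ : Module.Dual k V) (v : V) :
    mateR φ (tensorEquiv _ V (regOne k H ⊗ₜ v)) = φ v • regOne k H := by
  simp [mateR]

lemma regForm_mateR {V : FDMod k H} (l : Module.Dual k H) (φ : Module.Dual k V)
    (x : regular k H) (v : V) : regForm l (mateR φ (tensorEquiv _ V (x ⊗ₜ v))) =
      φ (antipode k (hitL l (regVal x)) • v) := by
  rw [mateR_tmul φ x v (ℛ k _), hitL_eq_sum _ (ℛ k _)]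
  simp only [map_sum, map_smul, Finset.sum_smul, smul_assoc, regForm_apply, regVal_regOne,
    smul_eq_mul]
  refine Finset.sum_congr rfl fun i _ => ?_
  rw [mul_comm, mul_one]

/-- `H ⊗ V` is free on the vectors `1 ⊗ vᵢ`; the morphisms `mateR` to the dual basis vectors are the
coordinates. -/
lemma sum_spanHom_comp_mateR (V : FDMod k H) {ι : Type*} [Fintype ι] (b : Module.Basis ι k V) :
    ∑ i, spanHom (tensorEquiv (regular k H) V (regOne k H ⊗ₜ b i)) ∘ₗ mateR (b.coord i) =
      LinearMap.id := by
  refine tensor_hom_ext fun x v => ?_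
  let r := ℛ k (regVal x)
  have h1 : ∀ w : V, ∑ i, b.coord i w • tensorEquiv (regular k H) V (regOne k H ⊗ₜ b i) =
      tensorEquiv (regular k H) V (regOne k H ⊗ₜ w) := fun w => by
    conv_rhs => rw [← b.sum_repr w]
    simp only [TensorProduct.tmul_sum, map_sum, TensorProduct.tmul_smul, map_smul,
      Module.Basis.coord_apply]
  trans ∑ i ∈ r.index, r.left i • tensorEquiv (regular k H) V
      (regOne k H ⊗ₜ (antipode k (r.right i) • v))
  · simp only [LinearMap.sum_apply, LinearMap.comp_apply, mateR_tmul _ x v r, map_sum,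
      LinearMap.map_smul_of_tower, map_smul, spanHom_regOne]
    rw [Finset.sum_comm]
    refine Finset.sum_congr rfl fun i _ => ?_
    rw [← h1, Finset.smul_sum]
    exact Finset.sum_congr rfl fun j _ => smul_comm _ _ _
  have key := congrArg ((tensorEquiv (regular k H) V).toLinearMap ∘ₗ TensorProduct.map
      ((LinearMap.toSpanSingleton H (regular k H) (regOne k H)).restrictScalars k)
      ((LinearMap.toSpanSingleton H V v).restrictScalars k ∘ₗ LinearMap.mul' k H ∘ₗ
        TensorProduct.map LinearMap.id (antipode k)))
    (sum_tmul_tmul_eq r (fun i => ℛ k (r.left i)) (fun i => ℛ k (r.right i)))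
  simp only [smul_tensorEquiv_tmul _ _ _ _ _ (ℛ k (r.left _)), map_sum]
  simp only [map_sum, LinearMap.comp_apply, TensorProduct.map_tmul, LinearEquiv.coe_coe,
    LinearMap.restrictScalars_apply, LinearMap.toSpanSingleton_apply, LinearMap.mul'_apply,
    LinearMap.id_apply, mul_smul] at key
  rw [key]
  have h2 : ∀ i, ∑ j ∈ (ℛ k (r.right i)).index,
      tensorEquiv (regular k H) V ((r.left i • regOne k H) ⊗ₜ
        ((ℛ k (r.right i)).left j • antipode k ((ℛ k (r.right i)).right j) • v)) =
      tensorEquiv (regular k H) V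
        ((counit (R := k) (r.right i) • (r.left i • regOne k H)) ⊗ₜ v) := fun i => by
    rw [← map_sum, ← TensorProduct.tmul_sum]
    simp only [← mul_smul]
    rw [← Finset.sum_smul, sum_mul_antipode_eq_smul, smul_assoc (counit (R := k) _), one_smul]
    exact congrArg _ (TensorProduct.smul_tmul (counit (R := k) (r.right i)) _ _).symm
  simp only [h2]
  rw [← map_sum, ← TensorProduct.sum_tmul, LinearMap.id_apply]
  congr 2
  have h3 := congrArg (· • regOne k H) (hitR_counit (k := k) (regVal x))
  simp only [hitR_eq_sum _ r, Finset.sum_smul, smul_assoc, regVal_smul_regOne] at h3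
  exact h3

variable (p : Pivot k H)

/-- The morphism `V ⊗ H → H`, `v ⊗ x ↦ φ(S(x₁) g v) x₂`, obtained by duality from the morphism
`H → V^* ⊗ H` with `1 ↦ φ ⊗ 1`. -/
def mateL {V : FDMod k H} (φ : Module.Dual k V) :
    tensor V (regular k H) →ₗ[H] regular k H :=
  (leftUnitor (regular k H)).toLinearMap ∘ₗ tensorHom (evTilde p V) LinearMap.id ∘ₗ
    (assoc V (dual V) (regular k H)).symm.toLinearMap ∘ₗ
    tensorHom LinearMap.id (spanHom (tensorEquiv _ _ (dualEquiv V φ ⊗ₜ regOne k H)))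

lemma mateL_tmul {V : FDMod k H} (φ : Module.Dual k V) (x : regular k H) (v : V) {ι : Type*}
    (r : Repr k (regVal x) ι) : mateL p φ (tensorEquiv V _ (v ⊗ₜ x)) =
      ∑ i ∈ r.index, φ (antipode k (r.left i) • (p.g : H) • v) • (r.right i • regOne k H) := by
  simp only [mateL, LinearMap.comp_apply, tensorHom_tmul, spanHom_apply,
    smul_tensorEquiv_tmul _ _ _ _ _ r, smul_dualEquiv, map_sum, TensorProduct.tmul_sum,
    LinearEquiv.coe_coe, LinearMap.id_apply, assoc_symm_tmul, evTilde_tmul, leftUnitor_tmul]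
  rfl

lemma mateL_regOne {V : FDMod k H} (φ : Module.Dual k V) (v : V) :
    mateL p φ (tensorEquiv V _ (v ⊗ₜ regOne k H)) = φ ((p.g : H) • v) • regOne k H := by
  simp [mateL]

lemma regForm_mateL {V : FDMod k H} (l : Module.Dual k H) (φ : Module.Dual k V)
    (x : regular k H) (v : V) : regForm l (mateL p φ (tensorEquiv V _ (v ⊗ₜ x))) =
      φ (antipode k (hitR l (regVal x)) • (p.g : H) • v) := by
  rw [mateL_tmul p φ x v (ℛ k _), hitR_eq_sum _ (ℛ k _)]
  simp only [map_sum, map_smul, Finset.sum_smul, smul_assoc, regForm_apply, regVal_regOne,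
    smul_eq_mul]
  refine Finset.sum_congr rfl fun i _ => ?_
  rw [mul_comm, mul_one]

/-- `V ⊗ H` is free on the vectors `g⁻¹ vᵢ ⊗ 1`, which also occur in the left partial trace; the
morphisms `mateL` to the dual basis vectors are the coordinates. -/
lemma sum_spanHom_comp_mateL (V : FDMod k H) {ι : Type*} [Fintype ι] (b : Module.Basis ι k V) :
    ∑ i, spanHom (tensorEquiv V (regular k H)
      ((((p.g⁻¹ : GroupLike k H) : H) • b i) ⊗ₜ regOne k H)) ∘ₗ mateL p (b.coord i) =
      LinearMap.id := by
  refine tensor_hom_ext fun v x => ?_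
  let r := ℛ k (regVal x)
  have h1 : ∀ y : H, ∑ i, b.coord i (antipode k y • (p.g : H) • v) • tensorEquiv V (regular k H)
      ((((p.g⁻¹ : GroupLike k H) : H) • b i) ⊗ₜ regOne k H) =
      tensorEquiv V (regular k H) ((p.antipodeInv y • v) ⊗ₜ regOne k H) := fun y => by
    have h0 := congrArg (((p.g⁻¹ : GroupLike k H) : H) • ·)
      (b.sum_repr (antipode k y • (p.g : H) • v))
    simp only [Finset.smul_sum, smul_comm _ (b.repr _ _)] at h0
    rw [p.antipodeInv_apply, mul_smul, mul_smul, ← h0]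
    simp only [TensorProduct.sum_tmul, map_sum, ← TensorProduct.smul_tmul', map_smul,
      Module.Basis.coord_apply]
  trans ∑ i ∈ r.index, r.right i • tensorEquiv V (regular k H)
      ((p.antipodeInv (r.left i) • v) ⊗ₜ regOne k H)
  · simp only [LinearMap.sum_apply, LinearMap.comp_apply, mateL_tmul p _ x v r, map_sum,
      LinearMap.map_smul_of_tower, map_smul, spanHom_regOne]
    rw [Finset.sum_comm]
    refine Finset.sum_congr rfl fun i _ => ?_
    rw [← h1, Finset.smul_sum]
    exact Finset.sum_congr rfl fun j _ => smul_comm _ _ _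
  have key := congrArg ((tensorEquiv V (regular k H)).toLinearMap ∘ₗ TensorProduct.map
      ((LinearMap.toSpanSingleton H V v).restrictScalars k ∘ₗ LinearMap.mul' k H ∘ₗ
        (TensorProduct.comm k H H).toLinearMap ∘ₗ TensorProduct.map p.antipodeInv LinearMap.id)
      ((LinearMap.toSpanSingleton H (regular k H) (regOne k H)).restrictScalars k) ∘ₗ
      (TensorProduct.assoc k H H H).symm.toLinearMap)
    (sum_tmul_tmul_eq r (fun i => ℛ k (r.left i)) (fun i => ℛ k (r.right i)))
  simp only [smul_tensorEquiv_tmul _ _ _ _ _ (ℛ k (r.right _)), map_sum]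
  simp only [map_sum, LinearMap.comp_apply, TensorProduct.map_tmul, LinearEquiv.coe_coe,
    LinearMap.restrictScalars_apply, LinearMap.toSpanSingleton_apply, LinearMap.mul'_apply,
    TensorProduct.comm_tmul, TensorProduct.assoc_symm_tmul,
    LinearMap.id_apply, mul_smul] at key
  rw [← key]
  have h2 : ∀ i, ∑ j ∈ (ℛ k (r.left i)).index,
      tensorEquiv V (regular k H) (((ℛ k (r.left i)).right j •
        p.antipodeInv ((ℛ k (r.left i)).left j) • v) ⊗ₜ (r.right i • regOne k H)) =
      tensorEquiv V (regular k H)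
        (v ⊗ₜ (counit (R := k) (r.left i) • (r.right i • regOne k H))) := fun i => by
    rw [← map_sum, ← TensorProduct.sum_tmul]
    simp only [← mul_smul]
    rw [← Finset.sum_smul, p.sum_mul_antipodeInv, smul_assoc, one_smul,
      TensorProduct.smul_tmul]
  simp only [h2]
  rw [← map_sum, ← TensorProduct.tmul_sum, LinearMap.id_apply]
  congr 2
  have h3 := congrArg (· • regOne k H) (sum_counit_smul (R := k) r)
  simp only [Finset.sum_smul, smul_assoc, regVal_smul_regOne] at h3
  exact h3

end Mates

/-! ### The partial trace property and integrals -/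

section PartialTrace

variable {k H : Type u} [Field k] [Ring H] [HopfAlgebra k H] [FiniteDimensional k H]
  (p : Pivot k H)

/-- A decomposition of `id_P` through `H` and a basis of `V` decompose `P ⊗ V` through `H`, by
freeness of `H ⊗ V`; both sides are then computed with the form on `H`. -/
lemma hasRightPartialTrace_of_mem {t : TraceFamily k H} (ht : IsCyclic t)
    (h : traceForm t ∈ symRightIntegrals p) : HasRightPartialTrace p t := by
  intro P V f
  rw [mem_symRightIntegrals] at h
  obtain ⟨n, a, c, hac⟩ := exists_frame P
  let b := Module.Basis.ofVectorSpace k V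
  have hframe : ∑ j : Fin n × Module.Basis.ofVectorSpaceIndex k V,
      spanHom (tensorEquiv P.1 V (a j.1 (regOne k H) ⊗ₜ b j.2)) ∘ₗ
        (mateR (b.coord j.2) ∘ₗ tensorHom (c j.1) LinearMap.id) = LinearMap.id := by
    rw [Fintype.sum_prod_type]
    have h1 : ∀ (j : Fin n) i, spanHom (tensorEquiv P.1 V (a j (regOne k H) ⊗ₜ b i)) =
        tensorHom (a j) LinearMap.id ∘ₗ
          spanHom (tensorEquiv (regular k H) V (regOne k H ⊗ₜ b i)) := fun j i => by
      rw [← spanHom_apply_regOne (tensorHom _ _ ∘ₗ _)]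
      simp
    refine tensor_hom_ext fun w v => ?_
    simp only [h1, LinearMap.sum_apply, LinearMap.comp_apply]
    have h2 : ∀ y, ∑ i, spanHom (tensorEquiv (regular k H) V (regOne k H ⊗ₜ b i))
        (mateR (b.coord i) y) = y := fun y => by
      simpa [LinearMap.sum_apply] using LinearMap.congr_fun (sum_spanHom_comp_mateR V b) y
    simp only [← map_sum, h2]
    have h3 := congrArg (fun y => tensorEquiv P.1 V (y ⊗ₜ v)) (LinearMap.congr_fun hac w)
    simpa [TensorProduct.sum_tmul] using h3
  have h4 : ∀ (φ : Module.Dual k V) (z : tensor (regular k H) V),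
      regForm (traceForm t) (mateR φ z) =
        regForm (traceForm t) (slotR _ (φ ∘ₗ V.act (p.g : H)) z) := fun φ z => by
    induction z using tensor_induction with
    | h0 => simp
    | hadd x y hx hy => simp only [map_add, hx, hy]
    | ht x v =>
      rw [regForm_mateR, h, map_smul (antipode k), p.antipode_g_inv, smul_assoc, map_smul φ, slotR_tmul,
        map_smul (regForm _), smul_eq_mul, smul_eq_mul, mul_comm, regForm_apply]
      rfl
  refine (ht.apply_eq_sum (P.tensorRight V) hframe f).trans ?_
  rw [ht.apply_eq_sum P hac, Fintype.sum_prod_type]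
  refine Finset.sum_congr rfl fun j _ => ?_
  rw [rightPartialTrace_apply p _ _ _ _ b, map_sum, map_sum]
  refine Finset.sum_congr rfl fun i _ => ?_
  rw [← slotR_tensorHom, ← h4]
  exact congrArg (fun y => regForm (traceForm t)
    (mateR (b.coord i) (tensorHom (c j) LinearMap.id (f y)))) (spanHom_regOne _)

/-- The partial trace property for the endomorphisms of `H ⊗ H` that factor through `H` already
forces the condition on the form. -/
lemma mem_of_hasRightPartialTrace {t : TraceFamily k H} (ht : IsCyclic t)
    (h : HasRightPartialTrace p t) : traceForm t ∈ symRightIntegrals p := by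
  rw [mem_symRightIntegrals]
  intro x
  let b := Module.Basis.ofVectorSpace k (regular k H)
  have h1 : ∀ φ : Module.Dual k (regular k H),
      φ (antipode k (hitL (traceForm t) x) • regOne k H) =
        φ (traceForm t x • (p.g : H) • regOne k H) := fun φ => by
    -- The test endomorphism maps `1 ⊗ w` to `φ(w) (x ⊗ 1)`.
    let z := tensorEquiv (regular k H) (regular k H) (regVal.symm x ⊗ₜ regOne k H)
    have h2 := h (regularProj k H) (regular k H) (spanHom z ∘ₗ mateR φ)
    have h3 := (ht.apply_comp ((regularProj k H).tensorRight (regular k H)) (spanHom z)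
      (mateR φ)).trans (congrArg (fun y => regForm (traceForm t) (mateR φ y)) (spanHom_regOne z))
    have h4 := regTrace_apply t
      (rightPartialTrace p (regular k H) (regular k H) (spanHom z ∘ₗ mateR φ))
    have h5 := h3.symm.trans (h2.trans h4)
    rw [regForm_mateR, rightPartialTrace_apply p _ _ _ _ b] at h5
    refine h5.trans ?_
    simp only [LinearMap.comp_apply, mateR_regOne, LinearMap.map_smul_of_tower, spanHom_regOne, z,
      slotR_tmul, map_sum, map_smul, act_apply, Module.Basis.coord_apply]
    conv_rhs => rw [← b.sum_repr ((p.g : H) • regOne k H)]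
    simp only [map_sum, map_smul, smul_eq_mul, regForm_apply, LinearEquiv.apply_symm_apply,
      Finset.mul_sum]
    exact Finset.sum_congr rfl fun i _ => by ring
  have h7 : antipode k (hitL (traceForm t) x) • regOne k H -
      traceForm t x • (p.g : H) • regOne k H = 0 :=
    (Module.forall_dual_apply_eq_zero_iff k _).1 fun φ => by rw [map_sub, h1 φ, sub_self]
  have h8 : antipode k (hitL (traceForm t) x) = traceForm t x • (p.g : H) := by
    have h9 := congrArg regVal (sub_eq_zero.1 h7)
    rw [← smul_assoc, map_smul regVal, map_smul regVal] at h9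
    simpa only [regVal_regOne, smul_eq_mul, mul_one] using h9
  rw [← p.antipodeInv_antipode (hitL _ x), h8, map_smul, p.antipodeInv_apply, p.antipode_g,
    p.inv_mul_self, mul_one]

/-- The mirror image of `hasRightPartialTrace_of_mem`. -/
lemma hasLeftPartialTrace_of_mem {t : TraceFamily k H} (ht : IsCyclic t)
    (h : traceForm t ∈ symLeftIntegrals p) : HasLeftPartialTrace p t := by
  intro P V f
  rw [mem_symLeftIntegrals] at h
  obtain ⟨n, a, c, hac⟩ := exists_frame P
  let b := Module.Basis.ofVectorSpace k V
  have hframe : ∑ j : Fin n × Module.Basis.ofVectorSpaceIndex k V,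
      spanHom (tensorEquiv V P.1
        ((((p.g⁻¹ : GroupLike k H) : H) • b j.2) ⊗ₜ a j.1 (regOne k H))) ∘ₗ
        (mateL p (b.coord j.2) ∘ₗ tensorHom LinearMap.id (c j.1)) = LinearMap.id := by
    rw [Fintype.sum_prod_type]
    have h1 : ∀ (j : Fin n) i, spanHom (tensorEquiv V P.1
        ((((p.g⁻¹ : GroupLike k H) : H) • b i) ⊗ₜ a j (regOne k H))) =
        tensorHom LinearMap.id (a j) ∘ₗ spanHom (tensorEquiv V (regular k H)
          ((((p.g⁻¹ : GroupLike k H) : H) • b i) ⊗ₜ regOne k H)) := fun j i => by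
      rw [← spanHom_apply_regOne (tensorHom _ _ ∘ₗ _)]
      simp
    refine tensor_hom_ext fun v w => ?_
    simp only [h1, LinearMap.sum_apply, LinearMap.comp_apply]
    have h2 : ∀ y, ∑ i, spanHom (tensorEquiv V (regular k H)
        ((((p.g⁻¹ : GroupLike k H) : H) • b i) ⊗ₜ regOne k H)) (mateL p (b.coord i) y) = y :=
      fun y => by
        have := LinearMap.congr_fun (sum_spanHom_comp_mateL p V b) y
        rwa [LinearMap.sum_apply] at this
    simp only [← map_sum, h2]
    have h3 := congrArg (fun y => tensorEquiv V P.1 (v ⊗ₜ y)) (LinearMap.congr_fun hac w)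
    simpa [TensorProduct.tmul_sum] using h3
  have h4 : ∀ (φ : Module.Dual k V) (z : tensor V (regular k H)),
      regForm (traceForm t) (mateL p φ z) = regForm (traceForm t) (slotL _ φ z) := fun φ z => by
    induction z using tensor_induction with
    | h0 => simp
    | hadd x y hx hy => simp only [map_add, hx, hy]
    | ht v x =>
      rw [regForm_mateL, h, map_smul (antipode k), p.antipode_g, smul_assoc, map_smul φ, slotL_tmul,
        map_smul (regForm _), ← mul_smul, p.inv_mul_self, one_smul, smul_eq_mul, smul_eq_mul, mul_comm,
        regForm_apply]
  refine (ht.apply_eq_sum (P.tensorLeft p V) hframe f).trans ?_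
  rw [ht.apply_eq_sum P hac, Fintype.sum_prod_type]
  refine Finset.sum_congr rfl fun j _ => ?_
  rw [leftPartialTrace_apply p _ _ _ _ b, map_sum, map_sum]
  refine Finset.sum_congr rfl fun i _ => ?_
  rw [← slotL_tensorHom, ← h4]
  exact congrArg (fun y => regForm (traceForm t)
    (mateL p (b.coord i) (tensorHom LinearMap.id (c j) (f y)))) (spanHom_regOne _)

/-- The mirror image of `mem_of_hasRightPartialTrace`. -/
lemma mem_of_hasLeftPartialTrace {t : TraceFamily k H} (ht : IsCyclic t)
    (h : HasLeftPartialTrace p t) : traceForm t ∈ symLeftIntegrals p := by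
  rw [mem_symLeftIntegrals]
  intro x
  let b := Module.Basis.ofVectorSpace k (regular k H)
  have h1 : ∀ φ : Module.Dual k (regular k H),
      φ (antipode k (hitR (traceForm t) x) • (p.g : H) • regOne k H) =
        φ (traceForm t x • regOne k H) := fun φ => by
    -- The test endomorphism maps `w ⊗ 1` to `φ(g w) (1 ⊗ x)`.
    let z := tensorEquiv (regular k H) (regular k H) (regOne k H ⊗ₜ regVal.symm x)
    have h2 := h (regularProj k H) (regular k H) (spanHom z ∘ₗ mateL p φ)
    have h3 := (ht.apply_comp ((regularProj k H).tensorLeft p (regular k H)) (spanHom z)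
      (mateL p φ)).trans
        (congrArg (fun y => regForm (traceForm t) (mateL p φ y)) (spanHom_regOne z))
    have h4 := regTrace_apply t
      (leftPartialTrace p (regular k H) (regular k H) (spanHom z ∘ₗ mateL p φ))
    have h5 := h3.symm.trans (h2.trans h4)
    rw [regForm_mateL, leftPartialTrace_apply p _ _ _ _ b] at h5
    refine h5.trans ?_
    simp only [LinearMap.comp_apply, mateL_regOne, LinearMap.map_smul_of_tower, spanHom_regOne, z,
      slotL_tmul, map_sum, map_smul, Module.Basis.coord_apply, ← mul_smul, p.mul_inv_self, one_smul]
    conv_rhs => rw [← b.sum_repr (regOne k H)]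
    simp only [map_sum, map_smul, smul_eq_mul, regForm_apply, LinearEquiv.apply_symm_apply,
      Finset.mul_sum]
    exact Finset.sum_congr rfl fun i _ => by ring
  have h7 : antipode k (hitR (traceForm t) x) • (p.g : H) • regOne k H -
      traceForm t x • regOne k H = 0 :=
    (Module.forall_dual_apply_eq_zero_iff k _).1 fun φ => by rw [map_sub, h1 φ, sub_self]
  have h8 : antipode k (hitR (traceForm t) x) * (p.g : H) = traceForm t x • 1 := by
    have h9 := congrArg regVal (sub_eq_zero.1 h7)
    rw [← mul_smul, map_smul regVal] at h9
    simp only [regVal_regOne, smul_eq_mul, mul_one] at h9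
    exact h9
  rw [← p.antipodeInv_antipode (hitR _ x)]
  have h9 := congrArg p.antipodeInv h8
  rw [p.antipodeInv_mul, p.antipodeInv_apply (p.g : H), p.antipode_g, p.inv_mul_self, mul_one,
    map_smul, p.antipodeInv_one] at h9
  rw [← p.mul_inv_cancel_left (p.antipodeInv _), h9, mul_smul_comm, mul_one]

lemma mem_rightModifiedTraces {t : TraceFamily k H} : t ∈ rightModifiedTraces p ↔
    IsCyclic t ∧ traceForm t ∈ symRightIntegrals p :=
  ⟨fun h => ⟨h.1, mem_of_hasRightPartialTrace p h.1 h.2⟩,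
    fun h => ⟨h.1, hasRightPartialTrace_of_mem p h.1 h.2⟩⟩

lemma mem_leftModifiedTraces {t : TraceFamily k H} : t ∈ leftModifiedTraces p ↔
    IsCyclic t ∧ traceForm t ∈ symLeftIntegrals p :=
  ⟨fun h => ⟨h.1, mem_of_hasLeftPartialTrace p h.1 h.2⟩,
    fun h => ⟨h.1, hasLeftPartialTrace_of_mem p h.1 h.2⟩⟩

end PartialTrace

/-! ### Classification of modified traces -/

section Classification

variable {k H : Type u} [Field k] [Ring H] [HopfAlgebra k H] [FiniteDimensional k H]

/-- `traceForm` is an isomorphism from a space of cyclic families, cut out by a condition on their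
forms, onto the space of these forms, provided that they are all symmetric. -/
def traceFormEquiv (T : Submodule k (TraceFamily k H)) (L : Submodule k (Module.Dual k H))
    (hT : ∀ t, t ∈ T ↔ IsCyclic t ∧ traceForm t ∈ L)
    (hL : ∀ φ ∈ L, ∀ x y, φ (x * y) = φ (y * x)) : T ≃ₗ[k] L where
  toFun t := ⟨traceForm t.1, ((hT _).1 t.2).2⟩
  map_add' _ _ := rfl
  map_smul' _ _ := rfl
  invFun φ := ⟨symTrace φ.1, (hT _).2 ⟨isCyclic_symTrace (hL _ φ.2), by
    rw [traceForm_symTrace (hL _ φ.2)]; exact φ.2⟩⟩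
  left_inv t := Subtype.ext <|
    (isCyclic_symTrace (hL _ ((hT _).1 t.2).2)).eq_of_traceForm_eq ((hT _).1 t.2).1
      (traceForm_symTrace (hL _ ((hT _).1 t.2).2))
  right_inv φ := Subtype.ext (traceForm_symTrace (hL _ φ.2))

/-- The classification common to right modified traces (`I` the right integrals, `g` the pivot) and
left modified traces (`I` the left integrals, `g` the inverse of the pivot). -/
theorem modifiedTraces_classification (T : Submodule k (TraceFamily k H))
    (I : Submodule k (Module.Dual k H))
    (g : GroupLike k H)
    (hT : ∀ t, t ∈ T ↔ IsCyclic t ∧ traceForm t ∈ I.map (LinearMap.mulLeft k (g : H)).dualMap)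
    (hsym : ∀ φ ∈ I.map (LinearMap.mulLeft k (g : H)).dualMap, ∀ x y, φ (x * y) = φ (y * x))
    (hnd : ∀ φ ∈ I.map (LinearMap.mulLeft k (g : H)).dualMap, φ ≠ 0 →
      ∀ a, (∀ x, φ (a * x) = 0) → a = 0)
    (hrank : Module.finrank k (I.map (LinearMap.mulLeft k (g : H)).dualMap) = 1) :
    (∃ e : T ≃ₗ[k] I.map (LinearMap.mulLeft k (g : H)).dualMap,
      ∀ (t : T) (f : regular k H →ₗ[H] regular k H),
        t.1 (regularProj k H) f = (e t).1 (valueAtOne f)) ∧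
    Module.finrank k T = 1 ∧
    Module.finrank k (I.map (LinearMap.mulLeft k (g : H)).dualMap) = 1 ∧
    (∀ t ∈ T, t ≠ 0 → IsNondegenerate t) ∧
    (∀ μ ∈ I, μ ≠ 0 → ∃! t : TraceFamily k H, t ∈ T ∧
      ∀ f : regular k H →ₗ[H] regular k H,
        t (regularProj k H) f = μ ((g : H) * valueAtOne f)) := by
  let e := traceFormEquiv T _ hT hsym
  refine ⟨⟨e, fun t f => regTrace_apply t.1 f⟩, e.finrank_eq.trans hrank, hrank,
    fun t ht ht0 => ?_, fun μ hμ _ => ?_⟩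
  · have h := (hT t).1 ht
    refine h.1.isNondegenerate (hsym _ h.2) (hnd _ h.2 fun h0 => ht0 ?_)
    exact congrArg Subtype.val ((e.map_eq_zero_iff (x := ⟨t, ht⟩)).1 (Subtype.ext h0))
  · have hφ := Submodule.mem_map_of_mem (f := (LinearMap.mulLeft k (g : H)).dualMap) hμ
    refine ⟨(e.symm ⟨_, hφ⟩).1, ⟨(e.symm ⟨_, hφ⟩).2, fun f => ?_⟩, fun t ⟨ht, h⟩ => ?_⟩
    · refine (regTrace_apply _ f).trans ?_
      rw [show traceForm (e.symm ⟨_, hφ⟩).1 = _ from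
        congrArg Subtype.val (e.apply_symm_apply ⟨_, hφ⟩)]
      rfl
    · suffices h0 : e ⟨t, ht⟩ = ⟨_, hφ⟩ from
        congrArg Subtype.val (e.symm_apply_apply ⟨t, ht⟩ ▸ congrArg e.symm h0)
      refine Subtype.ext (LinearMap.ext fun x => ?_)
      refine (h (spanHom (regVal.symm x))).trans ?_
      exact congrArg (fun y => μ ((g : H) * y)) (spanHom_regOne (regVal.symm x))

end Classification

end HopfTrace

end

theorem theorem1 {k H : Type u} [Field k] [Ring H] [HopfAlgebra k H] [FiniteDimensional k H]
    (p : HopfTrace.Pivot k H) (hH : HopfTrace.IsUnimodular k H) :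
    -- right modified traces
    ((∃ e : HopfTrace.rightModifiedTraces p ≃ₗ[k] HopfTrace.symRightIntegrals p,
        ∀ (t : HopfTrace.rightModifiedTraces p)
          (f : HopfTrace.FDMod.regular k H →ₗ[H] HopfTrace.FDMod.regular k H),
          t.1 (HopfTrace.regularProj k H) f = (e t).1 (HopfTrace.FDMod.valueAtOne f)) ∧
      Module.finrank k (HopfTrace.rightModifiedTraces p) = 1 ∧
      Module.finrank k (HopfTrace.symRightIntegrals p) = 1 ∧
      (∀ t ∈ HopfTrace.rightModifiedTraces p, t ≠ 0 → HopfTrace.IsNondegenerate t) ∧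
      (∀ μ ∈ HopfTrace.rightIntegrals k H, μ ≠ 0 →
        ∃! t : HopfTrace.TraceFamily k H, t ∈ HopfTrace.rightModifiedTraces p ∧
          ∀ f : HopfTrace.FDMod.regular k H →ₗ[H] HopfTrace.FDMod.regular k H,
            t (HopfTrace.regularProj k H) f =
              μ ((p.g : H) * HopfTrace.FDMod.valueAtOne f))) ∧
    -- left modified traces
    ((∃ e : HopfTrace.leftModifiedTraces p ≃ₗ[k] HopfTrace.symLeftIntegrals p,
        ∀ (t : HopfTrace.leftModifiedTraces p)
          (f : HopfTrace.FDMod.regular k H →ₗ[H] HopfTrace.FDMod.regular k H),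
          t.1 (HopfTrace.regularProj k H) f = (e t).1 (HopfTrace.FDMod.valueAtOne f)) ∧
      Module.finrank k (HopfTrace.leftModifiedTraces p) = 1 ∧
      Module.finrank k (HopfTrace.symLeftIntegrals p) = 1 ∧
      (∀ t ∈ HopfTrace.leftModifiedTraces p, t ≠ 0 → HopfTrace.IsNondegenerate t) ∧
      (∀ μ ∈ HopfTrace.leftIntegrals k H, μ ≠ 0 →
        ∃! t : HopfTrace.TraceFamily k H, t ∈ HopfTrace.leftModifiedTraces p ∧
          ∀ f : HopfTrace.FDMod.regular k H →ₗ[H] HopfTrace.FDMod.regular k H,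
            t (HopfTrace.regularProj k H) f =
              μ (((p.g⁻¹ : GroupLike k H) : H) * HopfTrace.FDMod.valueAtOne f))) ∧
    -- the balanced case
    (HopfTrace.IsUnibalanced p ↔
      ∀ t ∈ HopfTrace.rightModifiedTraces p, t ∈ HopfTrace.leftModifiedTraces p) := by
  refine ⟨HopfTrace.modifiedTraces_classification _ _ p.g
      (fun t => HopfTrace.mem_rightModifiedTraces p)
      (fun φ hφ => HopfTrace.symRightIntegral_mul_comm p hH hφ)
      (fun φ hφ hφ0 a => HopfTrace.eq_zero_of_symRightIntegral p hφ hφ0)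
      (HopfTrace.finrank_symRightIntegrals p),
    HopfTrace.modifiedTraces_classification _ _ p.g⁻¹
      (fun t => HopfTrace.mem_leftModifiedTraces p)
      (fun φ hφ => HopfTrace.symLeftIntegral_mul_comm p hH hφ)
      (fun φ hφ hφ0 a => HopfTrace.eq_zero_of_symLeftIntegral p hH hφ hφ0)
      (HopfTrace.finrank_symLeftIntegrals p), fun h t ht => ?_, fun h φ hφ => ?_⟩
  · rw [HopfTrace.mem_rightModifiedTraces] at ht
    exact (HopfTrace.mem_leftModifiedTraces p).2 ⟨ht.1, h _ ht.2⟩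
  · have hsym := HopfTrace.symRightIntegral_mul_comm p hH hφ
    have hform := HopfTrace.traceForm_symTrace hsym
    have ht := h (HopfTrace.symTrace φ) ((HopfTrace.mem_rightModifiedTraces p).2
      ⟨HopfTrace.isCyclic_symTrace hsym, by rwa [hform]⟩)
    rw [← hform]
    exact ((HopfTrace.mem_leftModifiedTraces p).1 ht).2
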